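/- Let $\mathsf{Gr}$ be the category with one object $\Lambda_n=\Lambda^\bullet(\mathbb R^n)$ for each $n\in\mathbb N_0$ (the real Grassmann algebra on $n$ odd generators), whose morphisms are the unital algebra homomorphisms preserving the $\mathbb Z/2$-grading. For a $\mathbb Z/2$-graded Fréchet space $V=V_{\bar 0}\oplus V_{\bar 1}$ let $\overline V(\Lambda)=(\Lambda_{\bar 0}\otimes V_{\bar 0})\oplus(\Lambda_{\bar 1}\otimes V_{\bar 1})$, with its natural topology and $\Lambda_{\bar 0}$-module structure, functorially in $\Lambda\in\mathsf{Gr}$. A natural transformation between open subfunctors of such functors is called supersmooth if each of its components is smooth (in the Michal–Bastiani sense) with $\Lambda_{\bar 0}$-linear derivatives. A (Fréchet) supermanifold is a functor $\mathcal M:\mathsf{Gr}\to\mathsf{Top}$ with Hausdorff values together with an atlas: a family of charts, i.e. natural isomorphisms of functors to topological spaces from open subfunctors of $\mathcal M$, covering $\mathcal M(\Lambda)$ for each $\Lambda$, onto open subfunctors of functors $\overline V$, such that all changes of charts are supersmooth. Morphisms of supermanifolds are the natural transformations (with continuous components) that are supersmooth in charts. The superpoint $\mathcal P(\Lambda)$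 of $\Lambda=\Lambda_n$ is the supermanifold $\Lambda'\mapsto\mathrm{Hom}_{\mathsf{Gr}}(\Lambda,\Lambda')\cong\overline{\mathbb R^{0|n}}(\Lambda')$, and a morphism $\varphi:\Lambda\to\Lambda'$ induces $\mathcal P(\varphi):\mathcal P(\Lambda')\to\mathcal P(\Lambda)$ by precomposition. Let $\mathcal M$ be a supermanifold. Let $\underline{\mathrm{Hom}}(\mathcal M,\mathcal M):\mathsf{Gr}\to\mathsf{Sets}$ be the functor $\Lambda\mapsto\mathrm{Hom}(\mathcal P(\Lambda)\times\mathcal M,\mathcal M)$, where $\varphi:\Lambda\to\Lambda'$ acts by $\sigma\mapsto\sigma\circ(\mathcal P(\varphi)\times\mathrm{id}_{\mathcal M})$. For $f,g\in\underline{\mathrm{Hom}}(\mathcal M,\mathcal M)(\Lambda)$ let $g\mathbin{\underline\circ}f$ be the morphism given on points by $(p,m)\mapsto g(p,f(p,m))$. The projection $\Pi_{\mathcal M}:\mathcal P(\Lambda)\times\mathcal M\to\mathcal M$ is the unit for $\underline\circ$. Let $\mathrm{SDiff}(\mathcal M)(\Lambda)$ be the set of those $f\in\underline{\mathrm{Hom}}(\mathcal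 M,\mathcal M)(\Lambda)$ for which there is a $g\in\underline{\mathrm{Hom}}(\mathcal M,\mathcal M)(\Lambda)$ with $f\mathbin{\underline\circ}g=g\mathbin{\underline\circ}f=\Pi_{\mathcal M}$. Then: 1. the sets $\mathrm{SDiff}(\mathcal M)(\Lambda)$ form a subfunctor $\mathrm{SDiff}(\mathcal M)$ of $\underline{\mathrm{Hom}}(\mathcal M,\mathcal M)$; 2. each $\mathrm{SDiff}(\mathcal M)(\Lambda)$ is a group with multiplication $\underline\circ$ and unit $\Pi_{\mathcal M}$, and for every morphism $\varphi:\Lambda\to\Lambda'$ of $\mathsf{Gr}$ the map $\underline{\mathrm{Hom}}(\mathcal M,\mathcal M)(\varphi)$ restricts to a group homomorphism $\mathrm{SDiff}(\mathcal M)(\Lambda)\to\mathrm{SDiff}(\mathcal M)(\Lambda')$; 3. $\mathrm{SDiff}(\mathcal M)$ is a group object in the functor category $\mathsf{Sets}^{\mathsf{Gr}}$, with multiplication, unit and inversion given for each $\Lambda$ by those of the group $\mathrm{SDiff}(\mathcal M)(\Lambda)$. -/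

import Mathlib

open CategoryTheory Topology Filter Set
open scoped TensorProduct

universe u v w

set_option linter.unusedSectionVars false

namespace SuperGeom

noncomputable section

/-! ### Smooth maps between locally convex spaces (Michal–Bastiani calculus) -/

section Calculus

/-- `d` is the directional derivative of `f` at `x` in the direction `h`. -/
def HasDirDeriv {E F : Type*} [AddCommGroup E] [Module ℝ E]
    [AddCommGroup F] [Module ℝ F] [TopologicalSpace F] (f : E → F) (x h : E) (d : F) : Prop :=
  Tendsto (fun t : ℝ => t⁻¹ • (f (x + t • h) - f x)) (𝓝[≠] 0) (𝓝 d)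

/-- `f` is of class `C^n` on the open set `U` in the sense of Michal and Bastiani: it is continuous
and, for `n ≥ 1`, all directional derivatives exist and form a `C^(n-1)` map `U × E → F`.
On Fréchet spaces this is the usual notion of a `C^n` map. -/
def IsCn {F : Type v} [AddCommGroup F] [Module ℝ F] [TopologicalSpace F] :
    ℕ → ∀ {E : Type u} [AddCommGroup E] [Module ℝ E] [TopologicalSpace E],
      (E → F) → Set E → Prop
  | 0, _, _, _, _, f, U => ContinuousOn f U
  | n + 1, E, _, _, _, f, U => ContinuousOn f U ∧ ∃ df : E × E → F,
      (∀ x ∈ U, ∀ h, HasDirDeriv f x h (df (x, h))) ∧ IsCn n df (U ×ˢ univ)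

/-- Locally convex Hausdorff topological vector spaces over `ℝ`. -/
class IsLCS (E : Type*) [AddCommGroup E] [Module ℝ E] [TopologicalSpace E] : Prop extends
    IsTopologicalAddGroup E, ContinuousSMul ℝ E, LocallyConvexSpace ℝ E, T2Space E

instance {E F : Type*} [AddCommGroup E] [Module ℝ E] [TopologicalSpace E] [IsLCS E]
    [AddCommGroup F] [Module ℝ F] [TopologicalSpace F] [IsLCS F] : IsLCS (E × F) where

variable {E : Type u} {F : Type v} {G : Type w}
  [AddCommGroup E] [Module ℝ E] [TopologicalSpace E]
  [AddCommGroup F] [Module ℝ F] [TopologicalSpace F]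
  [AddCommGroup G] [Module ℝ G] [TopologicalSpace G]

theorem HasDirDeriv.congr [IsLCS E] {f g : E → F} {U : Set E} (hU : IsOpen U) {x h : E} {d : F}
    (hx : x ∈ U) (hfg : EqOn f g U) (H : HasDirDeriv f x h d) : HasDirDeriv g x h d := by
  refine Tendsto.congr' ?_ H
  have hc : Continuous (fun t : ℝ => x + t • h) := by fun_prop
  have : ∀ᶠ t : ℝ in 𝓝 0, x + t • h ∈ U :=
    hc.continuousAt.eventually_mem (hU.mem_nhds (by simpa using hx))
  filter_upwards [this.filter_mono nhdsWithin_le_nhds] with t ht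
  rw [hfg ht, hfg hx]

theorem IsCn.continuousOn : ∀ {n : ℕ} {f : E → F} {U : Set E}, IsCn n f U → ContinuousOn f U
  | 0, _, _, h => h
  | _ + 1, _, _, h => h.1

theorem IsCn.of_succ : ∀ {n : ℕ} {E : Type u} [AddCommGroup E] [Module ℝ E] [TopologicalSpace E]
    {f : E → F} {U : Set E}, IsCn (n + 1) f U → IsCn n f U
  | 0, _, _, _, _, _, _, h => h.1
  | _ + 1, _, _, _, _, _, _, h => ⟨h.1, h.2.imp fun _ hd => ⟨hd.1, hd.2.of_succ⟩⟩

theorem IsCn.mono : ∀ {n : ℕ} {E : Type u} [AddCommGroup E] [Module ℝ E] [TopologicalSpace E]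
    {f : E → F} {U V : Set E}, IsCn n f U → V ⊆ U → IsCn n f V
  | 0, _, _, _, _, _, _, _, h, hV => ContinuousOn.mono h hV
  | _ + 1, _, _, _, _, _, _, _, h, hV => ⟨h.1.mono hV, h.2.imp fun _ hd =>
      ⟨fun x hx => hd.1 x (hV hx), hd.2.mono (prod_mono hV subset_rfl)⟩⟩

theorem IsCn.congr : ∀ {n : ℕ} {E : Type u} [AddCommGroup E] [Module ℝ E] [TopologicalSpace E]
    [IsLCS E] {f g : E → F} {U : Set E}, IsOpen U → EqOn f g U → IsCn n f U → IsCn n g U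
  | 0, _, _, _, _, _, _, _, _, _, hfg, h => ContinuousOn.congr h hfg.symm
  | _ + 1, _, _, _, _, _, _, _, _, hU, hfg, h => ⟨h.1.congr hfg.symm, h.2.imp fun _ hd =>
      ⟨fun x hx k => (hd.1 x hx k).congr hU hx hfg, hd.2⟩⟩

theorem IsCn.of_local [IsLCS F] : ∀ {n : ℕ} {E : Type u} [AddCommGroup E] [Module ℝ E]
    [TopologicalSpace E] [IsLCS E] {f : E → F} {U : Set E},
    (∀ x ∈ U, ∃ V, IsOpen V ∧ x ∈ V ∧ IsCn n f V) → IsCn n f U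
  | 0, _, _, _, _, _, _, _, h => fun x hx => by
      obtain ⟨V, hV, hxV, hc⟩ := h x hx
      exact (ContinuousOn.continuousAt hc (hV.mem_nhds hxV)).continuousWithinAt
  | n + 1, E, _, _, _, _, f, U, h => by
      classical
      refine ⟨fun x hx => ?_, ?_⟩
      · obtain ⟨V, hV, hxV, hc⟩ := h x hx
        exact (hc.1.continuousAt (hV.mem_nhds hxV)).continuousWithinAt
      · let df : E × E → F := fun p =>
          if H : ∃ d, HasDirDeriv f p.1 p.2 d then H.choose else 0
        have hdf : ∀ p d, HasDirDeriv f p.1 p.2 d → df p = d := fun p d hd => by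
          have H : ∃ d, HasDirDeriv f p.1 p.2 d := ⟨d, hd⟩
          simp only [df, dif_pos H]
          exact tendsto_nhds_unique H.choose_spec hd
        refine ⟨df, fun x hx k => ?_, IsCn.of_local fun p hp => ?_⟩
        · obtain ⟨V, hV, hxV, -, dg, hdg, -⟩ := h x hx
          rw [hdf (x, k) _ (hdg x hxV k)]
          exact hdg x hxV k
        · obtain ⟨V, hV, hxV, -, dg, hdg, hn⟩ := h p.1 hp.1
          have ho : IsOpen (V ×ˢ (univ : Set E)) := hV.prod isOpen_univ
          exact ⟨V ×ˢ univ, ho, ⟨hxV, mem_univ _⟩,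
            hn.congr ho fun q hq => (hdf q _ (hdg q.1 hq.1 q.2)).symm⟩

theorem hasDirDeriv_clm [IsLCS F] (L : E →L[ℝ] F) (x h : E) : HasDirDeriv L x h (L h) := by
  refine tendsto_const_nhds.congr' ?_
  filter_upwards [self_mem_nhdsWithin] with t ht
  have ht : t ≠ 0 := ht
  simp [smul_smul, ht]

theorem isCn_clm [IsLCS F] : ∀ (n : ℕ) {E : Type u} [AddCommGroup E] [Module ℝ E]
    [TopologicalSpace E] (L : E →L[ℝ] F) (U : Set E), IsCn n L U
  | 0, _, _, _, _, L, _ => L.continuous.continuousOn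
  | n + 1, E, _, _, _, L, _ => ⟨L.continuous.continuousOn, fun p => L p.2,
      fun x _ h => hasDirDeriv_clm L x h, isCn_clm n (L.comp (ContinuousLinearMap.snd ℝ E E)) _⟩

theorem hasDirDeriv_const (c : F) (x h : E) : HasDirDeriv (fun _ => c) x h 0 := by
  simp [HasDirDeriv, tendsto_const_nhds]

theorem isCn_const (n : ℕ) (c : F) (U : Set E) : IsCn n (fun _ : E => c) U := by
  have key : ∀ (n : ℕ) {E : Type u} [AddCommGroup E] [Module ℝ E] [TopologicalSpace E]
      (c : F) (U : Set E), IsCn n (fun _ : E => c) U := by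
    intro n
    induction n with
    | zero => intro E _ _ _ c U; exact continuousOn_const
    | succ n ih =>
      intro E _ _ _ c U
      exact ⟨continuousOn_const, fun _ => 0, fun x _ h => hasDirDeriv_const c x h, ih 0 _⟩
  exact key n c U

theorem HasDirDeriv.prodMk {f : E → F} {g : E → G} {x h : E} {d : F} {e : G}
    (hf : HasDirDeriv f x h d) (hg : HasDirDeriv g x h e) :
    HasDirDeriv (fun y => (f y, g y)) x h (d, e) :=
  (hf.prodMk_nhds hg).congr fun _ => rfl

theorem IsCn.prodMk : ∀ {n : ℕ} {E : Type u} [AddCommGroup E] [Module ℝ E]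
    [TopologicalSpace E] {f : E → F} {g : E → G} {U : Set E}, IsCn n f U → IsCn n g U →
    IsCn n (fun y => (f y, g y)) U
  | 0, _, _, _, _, _, _, _, hf, hg => ContinuousOn.prodMk hf hg
  | _ + 1, _, _, _, _, _, _, _, ⟨hf, df, hdf, hf'⟩, ⟨hg, dg, hdg, hg'⟩ =>
      ⟨hf.prodMk hg, fun p => (df p, dg p), fun x hx h => (hdf x hx h).prodMk (hdg x hx h),
        hf'.prodMk hg'⟩

theorem slope_mem [IsLCS E] [IsLCS F] {g : E → F} {y k : E} {t : ℝ} (ht : t ≠ 0) {C : Set F}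
    (hC : Convex ℝ C) (hC' : IsClosed C)
    (H : ∀ s ∈ uIcc 0 t, ∃ d ∈ C, HasDirDeriv g (y + s • k) k d) :
    t⁻¹ • (g (y + t • k) - g y) ∈ C := by
  by_contra hn
  obtain ⟨l, w, hw, hw'⟩ := geometric_hahn_banach_point_closed hC hC' hn
  choose! d hdC hd using H
  have hder : ∀ s ∈ uIcc 0 t, HasDerivAt (fun s => l (g (y + s • k))) (l (d s)) s := by
    intro s hs
    rw [hasDerivAt_iff_tendsto_slope_zero]
    have := (l.continuous.tendsto _).comp (hd s hs)
    refine this.congr fun r => ?_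
    simp [add_smul, add_assoc]
  have hval : l (t⁻¹ • (g (y + t • k) - g y)) = (l (g (y + t • k)) - l (g y)) / t := by
    simp [div_eq_inv_mul]
  rcases lt_or_gt_of_ne ht with h0 | h0
  · rw [uIcc_of_ge h0.le] at *
    obtain ⟨c, hc, he⟩ := exists_hasDerivAt_eq_slope (fun s => l (g (y + s • k)))
      (fun s => l (d s)) h0 (fun s hs => (hder s hs).continuousAt.continuousWithinAt)
      (fun s hs => hder s (Ioo_subset_Icc_self hs))
    have h1 := hw' _ (hdC c (Ioo_subset_Icc_self hc))
    rw [he] at h1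
    rw [hval] at hw
    simp only [zero_smul, add_zero, zero_sub, div_neg] at h1
    rw [← neg_div, neg_sub] at h1
    linarith
  · rw [uIcc_of_le h0.le] at *
    obtain ⟨c, hc, he⟩ := exists_hasDerivAt_eq_slope (fun s => l (g (y + s • k)))
      (fun s => l (d s)) h0 (fun s hs => (hder s hs).continuousAt.continuousWithinAt)
      (fun s hs => hder s (Ioo_subset_Icc_self hs))
    have h1 := hw' _ (hdC c (Ioo_subset_Icc_self hc))
    rw [he] at h1
    rw [hval] at hw
    simp only [zero_smul, add_zero, sub_zero] at h1
    linarith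

theorem HasDirDeriv.comp [IsLCS E] [IsLCS F] [IsLCS G] {g : F → G} {f : E → F} {V : Set F}
    (hV : IsOpen V) {dg : F × F → G} (hg : ∀ y ∈ V, ∀ k, HasDirDeriv g y k (dg (y, k)))
    (hdg : ContinuousOn dg (V ×ˢ univ)) {x h : E} {d : F} (hx : f x ∈ V)
    (hf : HasDirDeriv f x h d) : HasDirDeriv (g ∘ f) x h (dg (f x, d)) := by
  rw [HasDirDeriv, tendsto_def]
  intro N hN
  obtain ⟨C, ⟨hC, hCc, hCv⟩, hCN⟩ :
      ∃ C, (C ∈ 𝓝 (dg (f x, d)) ∧ IsClosed C ∧ Convex ℝ C) ∧ C ⊆ N := by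
    obtain ⟨N', hN', hN'c, hN'N⟩ := exists_mem_nhds_isClosed_subset hN
    obtain ⟨S, ⟨hS, hSc⟩, hSN⟩ := (LocallyConvexSpace.convex_basis (𝕜 := ℝ) (dg (f x, d))).mem_iff.1 hN'
    exact ⟨closure S, ⟨mem_of_superset hS subset_closure, isClosed_closure, hSc.closure⟩,
      (closure_minimal hSN hN'c).trans hN'N⟩
  have hmem : (f x, d) ∈ V ×ˢ (univ : Set F) := ⟨hx, mem_univ _⟩
  have ho : IsOpen (V ×ˢ (univ : Set F)) := hV.prod isOpen_univ
  have h1 : ∀ᶠ p in 𝓝 (f x, d), p ∈ V ×ˢ (univ : Set F) ∧ dg p ∈ C :=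
    (ho.eventually_mem hmem).and ((hdg.continuousAt (ho.mem_nhds hmem)).eventually_mem hC)
  have hc : Continuous (fun q : ℝ × F => (f x + q.1 • q.2, q.2)) := by fun_prop
  have h2 : ∀ᶠ q : ℝ × F in 𝓝 0 ×ˢ 𝓝 d, (f x + q.1 • q.2, q.2) ∈ V ×ˢ (univ : Set F) ∧
      dg (f x + q.1 • q.2, q.2) ∈ C := by
    rw [← nhds_prod_eq]
    have h1' : ∀ᶠ p in 𝓝 ((fun q : ℝ × F => (f x + q.1 • q.2, q.2)) (0, d)),
        p ∈ V ×ˢ (univ : Set F) ∧ dg p ∈ C := by simpa using h1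
    exact (hc.tendsto (0, d)).eventually h1'
  obtain ⟨pa, hpa, pb, hpb, hab⟩ := eventually_prod_iff.1 h2
  obtain ⟨δ, hδ, hball⟩ := Metric.eventually_nhds_iff.1 hpa
  have h3 : ∀ᶠ t : ℝ in 𝓝[≠] 0, pb (t⁻¹ • (f (x + t • h) - f x)) := hf.eventually hpb
  have h4 : ∀ᶠ t : ℝ in 𝓝[≠] 0, dist t 0 < δ :=
    (Metric.eventually_nhds_iff.2 ⟨δ, hδ, fun _ hy => hy⟩ : ∀ᶠ t : ℝ in 𝓝 0, dist t 0 < δ).filter_mono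
      nhdsWithin_le_nhds
  filter_upwards [h3, h4, self_mem_nhdsWithin] with t ht3 ht4 ht
  have ht : t ≠ 0 := ht
  apply hCN
  set k := t⁻¹ • (f (x + t • h) - f x) with hk
  have e : f (x + t • h) = f x + t • k := by simp [hk, smul_smul, ht]
  simp only [Function.comp, e]
  refine slope_mem ht hCv hCc fun s hs => ?_
  have hs' : dist s 0 < δ := by
    refine lt_of_le_of_lt ?_ ht4
    simp only [Real.dist_eq, sub_zero]
    rcases le_total 0 t with h0 | h0
    · rw [uIcc_of_le h0] at hs
      rw [abs_of_nonneg h0, abs_of_nonneg hs.1]; exact hs.2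
    · rw [uIcc_of_ge h0] at hs
      rw [abs_of_nonpos h0, abs_of_nonpos hs.2]; linarith [hs.1]
  have := hab (hball hs') ht3
  exact ⟨_, this.2, hg _ this.1.1 k⟩

theorem IsCn.comp_clm : ∀ {n : ℕ} {E D : Type u}
    [AddCommGroup E] [Module ℝ E] [TopologicalSpace E]
    [AddCommGroup D] [Module ℝ D] [TopologicalSpace D]
    {f : E → F} {U : Set E} {V : Set D} (L : D →L[ℝ] E), MapsTo L V U →
    IsCn n f U → IsCn n (fun x => f (L x)) V
  | 0, _, _, _, _, _, _, _, _, _, _, _, L, h, hf => ContinuousOn.comp hf L.continuous.continuousOn h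
  | _ + 1, _, _, _, _, _, _, _, _, _, _, _, L, h, ⟨hf, df, hdf, hf'⟩ =>
      And.intro (hf.comp L.continuous.continuousOn h) ⟨fun p => df ((L.prodMap L) p),
        fun x hx k => Tendsto.congr (fun t => by simp) (hdf (L x) (h hx) (L k)),
        IsCn.comp_clm (L.prodMap L) (fun _ hp => And.intro (h hp.1) (mem_univ _)) hf'⟩

theorem IsCn.comp : ∀ {n : ℕ} {E : Type u} {F : Type v} {G : Type w}
    [AddCommGroup E] [Module ℝ E] [TopologicalSpace E] [IsLCS E]
    [AddCommGroup F] [Module ℝ F] [TopologicalSpace F] [IsLCS F]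
    [AddCommGroup G] [Module ℝ G] [TopologicalSpace G] [IsLCS G]
    {g : F → G} {f : E → F} {U : Set E} {V : Set F}, IsOpen U → IsOpen V → MapsTo f U V →
    IsCn n g V → IsCn n f U → IsCn n (g ∘ f) U
  | 0, _, _, _, _, _, _, _, _, _, _, _, _, _, _, _, _, _, _, _, _, _, h, hg, hf => ContinuousOn.comp hg hf h
  | n + 1, E, F, G, _, _, _, _, _, _, _, _, _, _, _, _, g, f, U, V, hU, hV, h, hg, hf => by
      obtain ⟨hgc, dg, hdg, hg'⟩ := id hg
      obtain ⟨hfc, df, hdf, hf'⟩ := id hf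
      refine ⟨hgc.comp hfc h, dg ∘ fun p => (f p.1, df p),
        fun x hx k => HasDirDeriv.comp hV hdg hg'.continuousOn (h hx) (hdf x hx k), ?_⟩
      have hU' : IsOpen (U ×ˢ (univ : Set E)) := hU.prod isOpen_univ
      have h1 : IsCn n (fun p : E × E => f p.1) (U ×ˢ univ) :=
        IsCn.comp_clm (ContinuousLinearMap.fst ℝ E E) (fun p hp => hp.1) hf.of_succ
      exact IsCn.comp hU' (hV.prod isOpen_univ) (fun p hp => ⟨h hp.1, mem_univ _⟩) hg'
        (h1.prodMk hf')

/-! Smooth maps between locally convex modules over an algebra `R` whose derivatives are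
`R`-linear. -/

/-- `f` is smooth on the open set `U` and its derivative at each point of `U` is `R`-linear. -/
def IsSmoothLin (R : Type*) [Ring R] [Module R E] [Module R F] (f : E → F) (U : Set E) : Prop :=
  (∀ n, IsCn n f U) ∧ ∀ x ∈ U, ∃ L : E →ₗ[R] F, ∀ h, HasDirDeriv f x h (L h)

variable {R : Type*} [Ring R] [Module R E] [Module R F] [Module R G]
  [IsLCS E] [IsLCS F] [IsLCS G]

theorem IsSmoothLin.mono {f : E → F} {U V : Set E} (h : IsSmoothLin R f U) (hV : V ⊆ U) :
    IsSmoothLin R f V :=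
  ⟨fun n => (h.1 n).mono hV, fun x hx => h.2 x (hV hx)⟩

theorem IsSmoothLin.congr {f g : E → F} {U : Set E} (h : IsSmoothLin R f U) (hU : IsOpen U)
    (hfg : EqOn f g U) : IsSmoothLin R g U :=
  ⟨fun n => (h.1 n).congr hU hfg, fun x hx => (h.2 x hx).imp fun _ hL k =>
    (hL k).congr hU hx hfg⟩

theorem IsSmoothLin.of_local {f : E → F} {U : Set E}
    (h : ∀ x ∈ U, ∃ V, IsOpen V ∧ x ∈ V ∧ IsSmoothLin R f V) : IsSmoothLin R f U :=
  ⟨fun n => IsCn.of_local fun x hx => (h x hx).imp fun _ hV => ⟨hV.1, hV.2.1, hV.2.2.1 n⟩,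
    fun x hx => by
      obtain ⟨V, _, hxV, hf⟩ := h x hx
      exact hf.2 x hxV⟩

theorem isSmoothLin_clm (L : E →L[ℝ] F) (hL : ∀ (r : R) x, L (r • x) = r • L x) (U : Set E) :
    IsSmoothLin R L U :=
  ⟨fun n => isCn_clm n L U, fun x _ =>
    ⟨{ toFun := L, map_add' := L.map_add, map_smul' := hL }, fun h => hasDirDeriv_clm L x h⟩⟩

theorem isSmoothLin_const (c : F) (U : Set E) : IsSmoothLin R (fun _ : E => c) U :=
  ⟨fun n => isCn_const n c U, fun x _ => ⟨0, fun h => hasDirDeriv_const c x h⟩⟩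

theorem IsSmoothLin.prodMk {f : E → F} {g : E → G} {U : Set E} (hf : IsSmoothLin R f U)
    (hg : IsSmoothLin R g U) : IsSmoothLin R (fun x => (f x, g x)) U :=
  ⟨fun n => (hf.1 n).prodMk (hg.1 n), fun x hx => by
    obtain ⟨L, hL⟩ := hf.2 x hx
    obtain ⟨M, hM⟩ := hg.2 x hx
    exact ⟨L.prod M, fun h => (hL h).prodMk (hM h)⟩⟩

theorem IsSmoothLin.comp {g : F → G} {f : E → F} {U : Set E} {V : Set F} (hU : IsOpen U)
    (hV : IsOpen V) (h : MapsTo f U V) (hg : IsSmoothLin R g V) (hf : IsSmoothLin R f U) :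
    IsSmoothLin R (g ∘ f) U :=
  ⟨fun n => IsCn.comp hU hV h (hg.1 n) (hf.1 n), fun x hx => by
    obtain ⟨L, hL⟩ := hf.2 x hx
    obtain ⟨M, hM⟩ := hg.2 (f x) (h hx)
    obtain ⟨-, dg, hdg, hg'⟩ := hg.1 1
    refine ⟨M.comp L, fun k => ?_⟩
    have := HasDirDeriv.comp hV hdg hg'.continuousOn (h hx) (hL k)
    rwa [tendsto_nhds_unique (hdg (f x) (h hx) (L k)) (hM (L k))] at this⟩

theorem IsSmoothLin.add {f g : E → F} {U : Set E} (hU : IsOpen U) (hf : IsSmoothLin R f U)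
    (hg : IsSmoothLin R g U) : IsSmoothLin R (fun x => f x + g x) U := by
  have h := isSmoothLin_clm (R := R) (ContinuousLinearMap.fst ℝ F F + ContinuousLinearMap.snd ℝ F F)
    (fun r x => by simp) univ
  exact h.comp hU isOpen_univ (mapsTo_univ _ _) (hf.prodMk hg)

theorem IsSmoothLin.sum {ι : Type*} (s : Finset ι) {f : ι → E → F} {U : Set E} (hU : IsOpen U)
    (hf : ∀ i, IsSmoothLin R (f i) U) : IsSmoothLin R (fun x => ∑ i ∈ s, f i x) U := by
  classical
  induction s using Finset.induction_on with
  | empty => simpa using isSmoothLin_const (R := R) (0 : F) U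
  | insert i s hi ih => simpa [Finset.sum_insert hi] using (hf i).add hU ih

end Calculus

/-! ### Grassmann algebras -/

section Grassmann

/-- The real Grassmann algebra on `n` odd generators. -/
abbrev Gras (n : ℕ) : Type := ExteriorAlgebra ℝ (Fin n → ℝ)

/-- The even (`i = 0`) and the odd (`i = 1`) part of the Grassmann algebra. -/
abbrev Gras.part (n : ℕ) (i : ZMod 2) : Submodule ℝ (Gras n) :=
  CliffordAlgebra.evenOdd (0 : QuadraticForm ℝ (Fin n → ℝ)) i

/-- The even part as an algebra. -/
abbrev Gras.Even (n : ℕ) : Subalgebra ℝ (Gras n) :=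
  CliffordAlgebra.even (0 : QuadraticForm ℝ (Fin n → ℝ))

/-- The odd part. -/
abbrev Gras.Odd (n : ℕ) : Submodule ℝ (Gras n) := Gras.part n 1

/-- The odd generators. -/
abbrev Gras.gen (n : ℕ) (i : Fin n) : Gras n := ExteriorAlgebra.ι ℝ (Pi.single i 1)

theorem Gras.gen_mem (n : ℕ) (i : Fin n) : Gras.gen n i ∈ Gras.Odd n :=
  CliffordAlgebra.ι_mem_evenOdd_one _ _

theorem Gras.mul_mem {n : ℕ} {i j : ZMod 2} {x y : Gras n} (hx : x ∈ Gras.part n i)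
    (hy : y ∈ Gras.part n j) : x * y ∈ Gras.part n (i + j) :=
  SetLike.mul_mem_graded hx hy

instance (n : ℕ) : Module (Gras.Even n) (Gras.Odd n) where
  smul a x := ⟨a.1 * x.1, by simpa using Gras.mul_mem (i := 0) (j := 1) a.2 x.2⟩
  one_smul x := Subtype.ext (one_mul x.1)
  mul_smul a b x := Subtype.ext (mul_assoc a.1 b.1 x.1)
  smul_zero a := Subtype.ext (mul_zero a.1)
  smul_add a x y := Subtype.ext (mul_add a.1 x.1 y.1)
  add_smul a b x := Subtype.ext (add_mul a.1 b.1 x.1)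
  zero_smul x := Subtype.ext (zero_mul x.1)

theorem Gras.coe_smul_odd {n : ℕ} (a : Gras.Even n) (x : Gras.Odd n) :
    ((a • x : Gras.Odd n) : Gras n) = a.1 * x.1 := rfl

instance (n : ℕ) : SMulCommClass ℝ (Gras.Even n) (Gras.Odd n) where
  smul_comm r a x := Subtype.ext (by
    simp [Gras.coe_smul_odd])

theorem Gras.ι_mul_ι {n : ℕ} (v w : Fin n → ℝ) :
    (ExteriorAlgebra.ι ℝ v : Gras n) * ExteriorAlgebra.ι ℝ w
      = -(ExteriorAlgebra.ι ℝ w * ExteriorAlgebra.ι ℝ v) :=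
  eq_neg_of_add_eq_zero_left (ExteriorAlgebra.ι_add_mul_swap v w)

theorem Gras.even_comm {n : ℕ} {x : Gras n} (hx : x ∈ Gras.part n 0) (y : Gras n) :
    x * y = y * x := by
  induction x, hx using CliffordAlgebra.even_induction with
  | algebraMap r => exact Algebra.commutes r y
  | add x x' _ _ h h' => rw [add_mul, mul_add, h, h']
  | ι_mul_ι_mul v w x _ h =>
    have key : ∀ y : Gras n, (ExteriorAlgebra.ι ℝ v * ExteriorAlgebra.ι ℝ w) * y
        = y * (ExteriorAlgebra.ι ℝ v * ExteriorAlgebra.ι ℝ w) := by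
      intro y
      induction y using ExteriorAlgebra.induction with
      | algebraMap r => exact (Algebra.commutes r _).symm
      | ι u =>
        rw [mul_assoc, Gras.ι_mul_ι w u, mul_neg, ← mul_assoc, Gras.ι_mul_ι v u, neg_mul, neg_neg,
          mul_assoc]
      | mul a b ha hb => rw [← mul_assoc, ha, mul_assoc, hb, mul_assoc]
      | add a b ha hb => rw [mul_add, add_mul, ha, hb]
    have key' := key
    change (ExteriorAlgebra.ι ℝ v * ExteriorAlgebra.ι ℝ w) * x * y
      = y * ((ExteriorAlgebra.ι ℝ v * ExteriorAlgebra.ι ℝ w) * x)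
    rw [mul_assoc, h, ← mul_assoc, key', mul_assoc]

theorem Gras.odd_anticomm {n : ℕ} {x y : Gras n} (hx : x ∈ Gras.Odd n) (hy : y ∈ Gras.Odd n) :
    x * y = -(y * x) := by
  have h1 : ∀ v : Fin n → ℝ, ∀ z ∈ Gras.Odd n,
      ExteriorAlgebra.ι ℝ v * z = -(z * ExteriorAlgebra.ι ℝ v) := by
    intro v z hz
    induction z, hz using CliffordAlgebra.odd_induction with
    | ι w => exact Gras.ι_mul_ι v w
    | add z z' _ _ h h' => rw [mul_add, add_mul, h, h', neg_add]
    | ι_mul_ι_mul a b z _ h =>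
      rw [← mul_assoc, ← Gras.even_comm (CliffordAlgebra.ι_mul_ι_mem_evenOdd_zero _ a b),
        mul_assoc, h, mul_neg, mul_assoc _ z]
  induction x, hx using CliffordAlgebra.odd_induction with
  | ι v => exact h1 v y hy
  | add x x' _ _ h h' => rw [mul_add, add_mul, h, h', neg_add]
  | ι_mul_ι_mul a b x _ h =>
    rw [mul_assoc, h, mul_neg, ← mul_assoc,
      Gras.even_comm (CliffordAlgebra.ι_mul_ι_mem_evenOdd_zero _ a b), mul_assoc]

theorem Gras.odd_sq {n : ℕ} {x : Gras n} (hx : x ∈ Gras.Odd n) : x * x = 0 := by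
  have h := Gras.odd_anticomm hx hx
  have h2 : (2 : ℝ) • (x * x) = 0 := by
    rw [two_smul]; nth_rewrite 1 [h]; simp
  simpa using h2

/-- The category of finite-dimensional real Grassmann algebras. The object with `gens = n` is the
Grassmann algebra on `n` odd generators. -/
structure Gr : Type where
  /-- The number of odd generators. -/
  gens : ℕ

/-- The underlying algebra. -/
abbrev Gr.Alg (Λ : Gr) : Type := Gras Λ.gens

/-- Morphisms are the unital algebra homomorphisms preserving the `ℤ/2`-grading. -/
@[ext]
structure Gr.Hom (Λ Λ' : Gr) : Type where
  /-- The underlying algebra homomorphism. -/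
  toAlgHom : Λ.Alg →ₐ[ℝ] Λ'.Alg
  map_part : ∀ (i : ZMod 2), ∀ x ∈ Gras.part Λ.gens i, toAlgHom x ∈ Gras.part Λ'.gens i

instance : Category Gr where
  Hom := Gr.Hom
  id Λ := ⟨AlgHom.id ℝ _, fun _ _ h => h⟩
  comp φ ψ := ⟨ψ.toAlgHom.comp φ.toAlgHom, fun i x h => ψ.map_part i _ (φ.map_part i x h)⟩

theorem Gr.hom_ext_gen {Λ Λ' : Gr} {φ ψ : Λ ⟶ Λ'}
    (h : ∀ i, φ.toAlgHom (Gras.gen _ i) = ψ.toAlgHom (Gras.gen _ i)) : φ = ψ := by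
  refine Gr.Hom.ext (ExteriorAlgebra.hom_ext (LinearMap.pi_ext' fun i => ?_))
  ext
  exact h i

/-- The restriction of a morphism to the even parts. -/
def Gr.Hom.even {Λ Λ' : Gr} (φ : Λ ⟶ Λ') : Gras.Even Λ.gens →ₗ[ℝ] Gras.Even Λ'.gens where
  toFun x := ⟨φ.toAlgHom x.1, φ.map_part 0 x.1 x.2⟩
  map_add' x y := Subtype.ext (map_add φ.toAlgHom x.1 y.1)
  map_smul' r x := Subtype.ext (map_smul φ.toAlgHom r x.1)

/-- The restriction of a morphism to the odd parts. -/
def Gr.Hom.odd {Λ Λ' : Gr} (φ : Λ ⟶ Λ') : Gras.Odd Λ.gens →ₗ[ℝ] Gras.Odd Λ'.gens where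
  toFun x := ⟨φ.toAlgHom x.1, φ.map_part 1 x.1 x.2⟩
  map_add' x y := Subtype.ext (map_add φ.toAlgHom x.1 y.1)
  map_smul' r x := Subtype.ext (map_smul φ.toAlgHom r x.1)

/-- The linear map sending the generators to given odd elements. -/
def Gr.genMap (n : ℕ) (Λ : Gr) (ξ : Fin n → Gras.Odd Λ.gens) : (Fin n → ℝ) →ₗ[ℝ] Λ.Alg :=
  (Submodule.subtype _).comp (Fintype.linearCombination ℝ ξ)

theorem Gr.genMap_mem (n : ℕ) (Λ : Gr) (ξ : Fin n → Gras.Odd Λ.gens) (v : Fin n → ℝ) :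
    Gr.genMap n Λ ξ v ∈ Gras.Odd Λ.gens :=
  Subtype.property _

/-- The algebra homomorphism sending the generators to given odd elements. -/
def Gr.liftGens (n : ℕ) (Λ : Gr) (ξ : Fin n → Gras.Odd Λ.gens) : Gras n →ₐ[ℝ] Λ.Alg :=
  ExteriorAlgebra.lift ℝ ⟨Gr.genMap n Λ ξ, fun v => Gras.odd_sq (Gr.genMap_mem n Λ ξ v)⟩

theorem Gr.liftGens_ι (n : ℕ) (Λ : Gr) (ξ : Fin n → Gras.Odd Λ.gens) (v : Fin n → ℝ) :
    Gr.liftGens n Λ ξ (ExteriorAlgebra.ι ℝ v) = Gr.genMap n Λ ξ v :=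
  ExteriorAlgebra.lift_ι_apply ℝ _ _ v

theorem Gr.liftGens_odd_ι (n : ℕ) (Λ : Gr) (ξ : Fin n → Gras.Odd Λ.gens) (v : Fin n → ℝ) :
    Gr.liftGens n Λ ξ (ExteriorAlgebra.ι ℝ v) ∈ Gras.part Λ.gens 1 := by
  rw [Gr.liftGens_ι]; exact Gr.genMap_mem n Λ ξ v

theorem Gr.liftGens_even (n : ℕ) (Λ : Gr) (ξ : Fin n → Gras.Odd Λ.gens) (x : Gras n)
    (hx : x ∈ Gras.part n 0) : Gr.liftGens n Λ ξ x ∈ Gras.part Λ.gens 0 := by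
  induction x, hx using CliffordAlgebra.even_induction with
  | algebraMap r => 
    have : Gr.liftGens n Λ ξ (algebraMap ℝ _ r) = algebraMap ℝ _ r := AlgHom.commutes _ r
    erw [this]; exact SetLike.algebraMap_mem_graded _ _
  | add x y _ _ hx hy => rw [map_add]; exact add_mem hx hy
  | ι_mul_ι_mul a b x _ hx =>
    rw [map_mul, map_mul]
    exact Gras.mul_mem (i := 0) (j := 0)
      (Gras.mul_mem (i := 1) (j := 1) (Gr.liftGens_odd_ι n Λ ξ a) (Gr.liftGens_odd_ι n Λ ξ b)) hx

theorem Gr.liftGens_odd (n : ℕ) (Λ : Gr) (ξ : Fin n → Gras.Odd Λ.gens) (x : Gras n)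
    (hx : x ∈ Gras.part n 1) : Gr.liftGens n Λ ξ x ∈ Gras.part Λ.gens 1 := by
  induction x, hx using CliffordAlgebra.odd_induction with
  | ι v => exact Gr.liftGens_odd_ι n Λ ξ v
  | add x y _ _ hx hy => rw [map_add]; exact add_mem hx hy
  | ι_mul_ι_mul a b x _ hx =>
    rw [map_mul, map_mul]
    exact Gras.mul_mem (i := 0) (j := 1)
      (Gras.mul_mem (i := 1) (j := 1) (Gr.liftGens_odd_ι n Λ ξ a) (Gr.liftGens_odd_ι n Λ ξ b)) hx

/-- The morphism of Grassmann algebras sending the generators to given odd elements. -/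
def Gr.ofGens (Λ Λ' : Gr) (ξ : Fin Λ.gens → Gras.Odd Λ'.gens) : Λ ⟶ Λ' where
  toAlgHom := Gr.liftGens Λ.gens Λ' ξ
  map_part i x hx := by
    fin_cases i
    · exact Gr.liftGens_even _ _ ξ x hx
    · exact Gr.liftGens_odd _ _ ξ x hx

theorem Gr.ofGens_gen (Λ Λ' : Gr) (ξ : Fin Λ.gens → Gras.Odd Λ'.gens) (i : Fin Λ.gens) :
    (Gr.ofGens Λ Λ' ξ).toAlgHom (Gras.gen _ i) = ξ i := by
  change Gr.liftGens Λ.gens Λ' ξ _ = _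
  rw [Gr.liftGens_ι]
  simp [Gr.genMap]

/-- The universal property of Grassmann algebras: a morphism is the same as a family of odd
elements, the images of the generators. -/
def Gr.homEquiv (Λ Λ' : Gr) : (Λ ⟶ Λ') ≃ (Fin Λ.gens → Gras.Odd Λ'.gens) where
  toFun φ i := ⟨φ.toAlgHom (Gras.gen _ i), φ.map_part 1 _ (Gras.gen_mem _ i)⟩
  invFun := Gr.ofGens Λ Λ'
  left_inv _ := Gr.hom_ext_gen fun i => Gr.ofGens_gen _ _ _ i
  right_inv _ := funext fun i => Subtype.ext (Gr.ofGens_gen _ _ _ i)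

end Grassmann

/-! ### Tensor products with finite-dimensional spaces and superrepresentable modules -/

section Tensor

variable {A B : Type} [AddCommGroup A] [Module ℝ A] [AddCommGroup B] [Module ℝ B]
  {E F : Type u} [AddCommGroup E] [Module ℝ E] [AddCommGroup F] [Module ℝ F]

/-- Contraction with a linear functional on `A`: it sends `a ⊗ x` to `l a • x`. -/
def FTensor.contract (l : A →ₗ[ℝ] ℝ) : A ⊗[ℝ] E →ₗ[ℝ] E :=
  (TensorProduct.lid ℝ E).toLinearMap ∘ₗ TensorProduct.map l LinearMap.id

theorem FTensor.contract_tmul (l : A →ₗ[ℝ] ℝ) (a : A) (x : E) :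
    FTensor.contract l (a ⊗ₜ[ℝ] x) = l a • x := by
  simp [FTensor.contract]

/-- All contractions at once. -/
def FTensor.contractAll : A ⊗[ℝ] E →ₗ[ℝ] ((A →ₗ[ℝ] ℝ) → E) :=
  LinearMap.pi FTensor.contract

/-- The topology of coordinatewise convergence: the coarsest one for which all the contractions are
continuous. If `A` has dimension `d`, a basis of `A` identifies it with the product topology on
`E^d`. -/
instance [TopologicalSpace E] : TopologicalSpace (A ⊗[ℝ] E) :=
  TopologicalSpace.induced FTensor.contractAll inferInstance

theorem FTensor.contractAll_injective : Function.Injective (FTensor.contractAll (A := A) (E := E)) := by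
  rw [injective_iff_map_eq_zero]
  intro x hx
  let b := Module.Free.chooseBasis ℝ A
  let e := TensorProduct.equivFinsuppOfBasisLeft (N := E) b
  refine e.injective ?_
  rw [map_zero]
  ext i
  have key : (Finsupp.lapply i ∘ₗ e.toLinearMap : A ⊗[ℝ] E →ₗ[ℝ] E)
      = FTensor.contract (b.coord i) := by
    refine TensorProduct.ext' fun a y => ?_
    simp [e, FTensor.contract_tmul]
  exact (LinearMap.congr_fun key x).trans (congrFun hx (b.coord i))

/-- The canonical isomorphism `A ⊗ (E × F) ≅ (A ⊗ E) × (A ⊗ F)`. -/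
def FTensor.prodEquiv : A ⊗[ℝ] (E × F) ≃ₗ[ℝ] A ⊗[ℝ] E × A ⊗[ℝ] F :=
  TensorProduct.prodRight ℝ ℝ A E F

theorem FTensor.prodEquiv_tmul (a : A) (x : E × F) :
    FTensor.prodEquiv (a ⊗ₜ[ℝ] x) = (a ⊗ₜ[ℝ] x.1, a ⊗ₜ[ℝ] x.2) := rfl

variable [TopologicalSpace E] [TopologicalSpace F]

instance [IsLCS E] : IsLCS (A ⊗[ℝ] E) where
  toIsTopologicalAddGroup := topologicalAddGroup_induced FTensor.contractAll
  toContinuousSMul := continuousSMul_induced FTensor.contractAll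
  toLocallyConvexSpace := LocallyConvexSpace.induced FTensor.contractAll
  toT2Space := T2Space.of_injective_continuous FTensor.contractAll_injective continuous_induced_dom

theorem FTensor.continuous_contract (l : A →ₗ[ℝ] ℝ) :
    Continuous (FTensor.contract (E := E) l) :=
  (continuous_apply (A := fun _ => E) l).comp
    (continuous_induced_dom (f := ⇑(FTensor.contractAll (A := A) (E := E))))

theorem FTensor.continuous_of_contract {X : Type*} [TopologicalSpace X] {f : X → A ⊗[ℝ] E}
    (h : ∀ l : A →ₗ[ℝ] ℝ, Continuous fun x => FTensor.contract l (f x)) : Continuous f :=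
  continuous_induced_rng.2 (continuous_pi h)

/-- The continuous linear map `f ⊗ id`. -/
def FTensor.mapL (f : A →ₗ[ℝ] B) : A ⊗[ℝ] E →L[ℝ] B ⊗[ℝ] E where
  toLinearMap := TensorProduct.map f LinearMap.id
  cont := FTensor.continuous_of_contract fun l => by
    have key : (FTensor.contract (l ∘ₗ f) : A ⊗[ℝ] E →ₗ[ℝ] E)
        = FTensor.contract l ∘ₗ TensorProduct.map f LinearMap.id :=
      TensorProduct.ext' fun a y => by simp [FTensor.contract_tmul]
    exact (FTensor.continuous_contract (l ∘ₗ f)).congr fun x => LinearMap.congr_fun key x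

theorem FTensor.mapL_tmul (f : A →ₗ[ℝ] B) (a : A) (x : E) :
    FTensor.mapL f (a ⊗ₜ[ℝ] x) = f a ⊗ₜ[ℝ] x := rfl

theorem FTensor.continuous_prodEquiv {A : Type} [AddCommGroup A] [Module ℝ A] {E F : Type u}
    [AddCommGroup E] [Module ℝ E] [AddCommGroup F] [Module ℝ F]
    [TopologicalSpace E] [TopologicalSpace F] :
    Continuous (FTensor.prodEquiv (A := A) (E := E) (F := F)) := by
  refine Continuous.prodMk (FTensor.continuous_of_contract fun l => ?_)
    (FTensor.continuous_of_contract fun l => ?_)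
  · have key : (FTensor.contract l ∘ₗ LinearMap.fst ℝ _ _ ∘ₗ FTensor.prodEquiv.toLinearMap :
        A ⊗[ℝ] (E × F) →ₗ[ℝ] E) = LinearMap.fst ℝ _ _ ∘ₗ FTensor.contract l :=
      TensorProduct.ext' fun a y => by simp [FTensor.contract_tmul, FTensor.prodEquiv_tmul]
    exact (continuous_fst.comp (FTensor.continuous_contract l)).congr fun x =>
      (LinearMap.congr_fun key x).symm
  · have key : (FTensor.contract l ∘ₗ LinearMap.snd ℝ _ _ ∘ₗ FTensor.prodEquiv.toLinearMap :
        A ⊗[ℝ] (E × F) →ₗ[ℝ] F) = LinearMap.snd ℝ _ _ ∘ₗ FTensor.contract l :=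
      TensorProduct.ext' fun a y => by simp [FTensor.contract_tmul, FTensor.prodEquiv_tmul]
    exact (continuous_snd.comp (FTensor.continuous_contract l)).congr fun x =>
      (LinearMap.congr_fun key x).symm

theorem FTensor.contract_prodEquiv_symm {A : Type} [AddCommGroup A] [Module ℝ A] {E F : Type u}
    [AddCommGroup E] [Module ℝ E] [AddCommGroup F] [Module ℝ F]
    (l : A →ₗ[ℝ] ℝ) (x : A ⊗[ℝ] E × A ⊗[ℝ] F) :
    FTensor.contract l (FTensor.prodEquiv.symm x)
      = (FTensor.contract l x.1, FTensor.contract l x.2) := by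
  obtain ⟨x, rfl⟩ := FTensor.prodEquiv.surjective x
  rw [LinearEquiv.symm_apply_apply]
  have key : (FTensor.contract l : A ⊗[ℝ] (E × F) →ₗ[ℝ] E × F) =
      ((FTensor.contract l ∘ₗ LinearMap.fst ℝ _ _).prod (FTensor.contract l ∘ₗ LinearMap.snd ℝ _ _))
        ∘ₗ FTensor.prodEquiv.toLinearMap :=
    TensorProduct.ext' fun a y => by
      simp [FTensor.contract_tmul, FTensor.prodEquiv_tmul, Prod.smul_def]
  exact LinearMap.congr_fun key x

theorem FTensor.continuous_prodEquiv_symm {A : Type} [AddCommGroup A] [Module ℝ A] {E F : Type u}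
    [AddCommGroup E] [Module ℝ E] [AddCommGroup F] [Module ℝ F]
    [TopologicalSpace E] [TopologicalSpace F] :
    Continuous (FTensor.prodEquiv (A := A) (E := E) (F := F)).symm := by
  refine FTensor.continuous_of_contract fun l => ?_
  simp_rw [FTensor.contract_prodEquiv_symm]
  exact ((FTensor.continuous_contract l).comp continuous_fst).prodMk
    ((FTensor.continuous_contract l).comp continuous_snd)

theorem FTensor.prodEquiv_smul {A : Type} [AddCommGroup A] [Module ℝ A] {R : Type*} [Ring R]
    [Module R A] [SMulCommClass ℝ R A] {E F : Type u}
    [AddCommGroup E] [Module ℝ E] [AddCommGroup F] [Module ℝ F] (r : R) (x : A ⊗[ℝ] (E × F)) :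
    FTensor.prodEquiv (r • x) = r • FTensor.prodEquiv x := by
  induction x using TensorProduct.induction_on with
  | zero => simp
  | tmul a e =>
    rw [TensorProduct.smul_tmul', FTensor.prodEquiv_tmul, FTensor.prodEquiv_tmul]; rfl
  | add x y hx hy => rw [smul_add, map_add, hx, hy, map_add, smul_add]

theorem FTensor.mapL_prodEquiv {A B : Type} [AddCommGroup A] [Module ℝ A] 
    [AddCommGroup B] [Module ℝ B] {E F : Type u}
    [AddCommGroup E] [Module ℝ E] [AddCommGroup F] [Module ℝ F]
    [TopologicalSpace E] [TopologicalSpace F] (f : A →ₗ[ℝ] B) (x : A ⊗[ℝ] (E × F)) :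
    FTensor.prodEquiv (FTensor.mapL f x)
      = (FTensor.mapL f (FTensor.prodEquiv x).1, FTensor.mapL f (FTensor.prodEquiv x).2) := by
  induction x using TensorProduct.induction_on with
  | zero => simp only [map_zero]; rfl
  | tmul a e => rfl
  | add x y hx hy => simp only [map_add, hx, hy, Prod.fst_add, Prod.snd_add, Prod.mk_add_mk]

end Tensor

/-! ### Finite-dimensionality and the topology of the Grassmann algebras -/

section GrassmannTopology

theorem Gras.finite (n : ℕ) : Module.Finite ℝ (Gras n) := by
  have h0 : ∀ i : ℕ, n < i → (⋀[ℝ]^i (Fin n → ℝ) : Submodule ℝ (Gras n)) = ⊥ := by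
    intro i hi
    have h := exteriorPower.finrank_eq (R := ℝ) (M := Fin n → ℝ) i
    rw [Module.finrank_fin_fun, Nat.choose_eq_zero_of_lt hi] at h
    exact Submodule.finrank_eq_zero.1 h
  have h1 : (⨆ i : Fin (n + 1), (⋀[ℝ]^(i : ℕ) (Fin n → ℝ) : Submodule ℝ (Gras n))) = ⊤ := by
    rw [eq_top_iff, ← CliffordAlgebra.iSup_ι_range_eq_top (Q := (0 : QuadraticForm ℝ (Fin n → ℝ)))]
    refine iSup_le fun i => ?_
    rcases lt_or_ge n i with hi | hi
    · exact (h0 i hi).le.trans bot_le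
    · exact le_iSup (fun i : Fin (n + 1) => (⋀[ℝ]^(i : ℕ) (Fin n → ℝ) : Submodule ℝ (Gras n)))
        ⟨i, by omega⟩
  rw [Module.finite_def, ← h1]
  exact Submodule.fg_iSup _ fun i => (Module.Finite.iff_fg.1 inferInstance)

/-- All coordinates of an element of a Grassmann algebra. -/
def Gras.coords (n : ℕ) : Gras n →ₗ[ℝ] ((Gras n →ₗ[ℝ] ℝ) → ℝ) := LinearMap.pi id

/-- The usual topology of a Grassmann algebra as a finite-dimensional real vector space. -/
abbrev Gras.topology (n : ℕ) : TopologicalSpace (Gras n) :=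
  TopologicalSpace.induced (Gras.coords n) inferInstance

attribute [local instance] Gras.topology Gras.finite

theorem Gras.coords_injective (n : ℕ) : Function.Injective (Gras.coords n) := by
  rw [injective_iff_map_eq_zero]
  intro x hx
  exact (Module.forall_dual_apply_eq_zero_iff ℝ x).1 fun l => congrFun hx l

theorem Gras.isLCS (n : ℕ) : IsLCS (Gras n) where
  toIsTopologicalAddGroup := topologicalAddGroup_induced (Gras.coords n)
  toContinuousSMul := continuousSMul_induced (Gras.coords n)
  toLocallyConvexSpace := LocallyConvexSpace.induced (Gras.coords n)
  toT2Space := T2Space.of_injective_continuous (Gras.coords_injective n) continuous_induced_dom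

attribute [local instance] Gras.isLCS

theorem Gras.continuous_of_coords {n : ℕ} {X : Type*} [TopologicalSpace X] {f : X → Gras n}
    (h : ∀ l : Gras n →ₗ[ℝ] ℝ, Continuous fun x => l (f x)) : Continuous f :=
  continuous_induced_rng.2 (continuous_pi h)

theorem Gras.continuousMul (n : ℕ) : ContinuousMul (Gras n) where
  continuous_mul := by
    let b := Module.finBasis ℝ (Gras n)
    have h : (fun p : Gras n × Gras n => p.1 * p.2)
        = fun p => ∑ i, b.coord i p.1 • (LinearMap.mulLeft ℝ (b i)) p.2 := by
      funext p
      conv_lhs => rw [← b.sum_repr p.1, Finset.sum_mul]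
      simp
    rw [h]
    refine continuous_finsetSum _ fun i _ => ?_
    have h1 : Continuous (b.coord i) := LinearMap.continuous_of_finiteDimensional _
    have h2 : Continuous (LinearMap.mulLeft ℝ (b i)) := LinearMap.continuous_of_finiteDimensional _
    exact (h1.comp continuous_fst).smul (h2.comp continuous_snd)

attribute [local instance] Gras.continuousMul

variable {n : ℕ} {E : Type u} [AddCommGroup E] [Module ℝ E] [TopologicalSpace E]

theorem Gras.hasDirDeriv_mul {f g : E → Gras n} {x h : E} {d e : Gras n} 
    (hf : HasDirDeriv f x h d) (hg : HasDirDeriv g x h e) :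
    HasDirDeriv (fun y => f y * g y) x h (d * g x + f x * e) := by
  have h0 : Tendsto (fun t : ℝ => t) (𝓝[≠] 0) (𝓝 0) := tendsto_id.mono_left nhdsWithin_le_nhds
  have h1 : Tendsto (fun t : ℝ => g (x + t • h)) (𝓝[≠] 0) (𝓝 (g x)) := by
    have := (h0.smul hg).const_add (g x)
    rw [zero_smul, add_zero] at this
    refine this.congr' ?_
    filter_upwards [self_mem_nhdsWithin] with t ht
    have ht : t ≠ 0 := ht
    simp [smul_smul, ht]
  refine ((hf.mul h1).add (hg.const_mul (f x))).congr fun t => ?_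
  simp only [smul_mul_assoc, mul_smul_comm, ← smul_add]
  congr 1
  noncomm_ring

theorem Gras.isCn_mul : ∀ (m : ℕ) {E : Type u} [AddCommGroup E] [Module ℝ E] [TopologicalSpace E]
    [IsLCS E] {f g : E → Gras n} {U : Set E}, IsOpen U → IsCn m f U → IsCn m g U →
    IsCn m (fun y => f y * g y) U
  | 0, _, _, _, _, _, _, _, _, _, hf, hg => ContinuousOn.mul hf hg
  | m + 1, E, _, _, _, _, f, g, U, hU, hf, hg => by
      obtain ⟨hfc, df, hdf, hf'⟩ := id hf
      obtain ⟨hgc, dg, hdg, hg'⟩ := id hg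
      have hU' : IsOpen (U ×ˢ (univ : Set E)) := hU.prod isOpen_univ
      have h1 : ∀ {f : E → Gras n}, IsCn (m + 1) f U → IsCn m (fun p : E × E => f p.1) (U ×ˢ univ) :=
        fun hf => IsCn.comp_clm (ContinuousLinearMap.fst ℝ E E) (fun p hp => hp.1) hf.of_succ
      refine ⟨hfc.mul hgc, fun p => df p * g p.1 + f p.1 * dg p,
        fun x hx k => Gras.hasDirDeriv_mul (hdf x hx k) (hdg x hx k), ?_⟩
      have h2 := Gras.isCn_mul m hU' hf' (h1 hg)
      have h3 := Gras.isCn_mul m hU' (h1 hf) hg'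
      exact IsCn.comp (g := ⇑(ContinuousLinearMap.fst ℝ (Gras n) (Gras n)
        + ContinuousLinearMap.snd ℝ (Gras n) (Gras n))) hU' isOpen_univ (mapsTo_univ _ _)
        (isCn_clm m _ _) (h2.prodMk h3)

theorem Gras.isSmoothLin_mul [IsLCS E] [Module (Gras.Even n) E] {f g : E → Gras n} {U : Set E}
    (hU : IsOpen U) (hf : IsSmoothLin (Gras.Even n) f U) (hg : IsSmoothLin (Gras.Even n) g U) :
    IsSmoothLin (Gras.Even n) (fun y => f y * g y) U :=
  ⟨fun m => Gras.isCn_mul m hU (hf.1 m) (hg.1 m), fun x hx => by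
    obtain ⟨L, hL⟩ := hf.2 x hx
    obtain ⟨M, hM⟩ := hg.2 x hx
    refine ⟨{ toFun := fun h => L h * g x + f x * M h, map_add' := ?_, map_smul' := ?_ },
      fun h => Gras.hasDirDeriv_mul (hL h) (hM h)⟩
    · intro h k
      simp only [map_add, add_mul, mul_add]
      abel
    · intro r h
      simp only [map_smul, RingHom.id_apply, smul_add]
      congr 1
      · exact mul_assoc _ _ _
      · change f x * (r.1 * M h) = r.1 * (f x * M h)
        rw [← mul_assoc, ← Gras.even_comm r.2 (f x), mul_assoc]⟩

/-- The projection onto the odd part. -/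
def Gras.oddPart (n : ℕ) : Gras n →ₗ[ℝ] Gras.Odd n :=
  Submodule.projectionOnto (Gras.part n 1) (Gras.part n 0)
    (CliffordAlgebra.evenOdd_isCompl (Q := (0 : QuadraticForm ℝ (Fin n → ℝ)))).symm

theorem Gras.oddPart_coe (x : Gras.Odd n) : Gras.oddPart n x = x :=
  Submodule.projectionOnto_apply_left _ x

theorem Gras.oddPart_of_even {x : Gras n} (hx : x ∈ Gras.part n 0) : Gras.oddPart n x = 0 :=
  (Submodule.projectionOnto_apply_eq_zero_iff _).2 hx

theorem Gras.oddPart_smul (r : Gras.Even n) (x : Gras n) :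
    Gras.oddPart n (r • x) = r • Gras.oddPart n x := by
  have hx : x ∈ Gras.part n 0 ⊔ Gras.part n 1 := by
    rw [(CliffordAlgebra.evenOdd_isCompl (Q := (0 : QuadraticForm ℝ (Fin n → ℝ)))).sup_eq_top]
    trivial
  obtain ⟨a, ha, b, hb, rfl⟩ := Submodule.mem_sup.1 hx
  have h1 : r • a ∈ Gras.part n 0 := by
    simpa using! Gras.mul_mem (i := 0) (j := 0) r.2 ha
  rw [smul_add, map_add, map_add, Gras.oddPart_of_even h1, Gras.oddPart_of_even ha, zero_add,
    zero_add]
  have h2 : r • b = ((r • (⟨b, hb⟩ : Gras.Odd n) : Gras.Odd n) : Gras n) := rfl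
  have h3 : Gras.oddPart n b = ⟨b, hb⟩ := Gras.oddPart_coe ⟨b, hb⟩
  rw [h2, Gras.oddPart_coe, h3]

end GrassmannTopology

/-! ### Fréchet super vector spaces and their functors of points -/

section SuperVect

/-- The even part `(Λ₀ ⊗ V₀) ⊕ (Λ₁ ⊗ V₁)` of `Λ ⊗ V` for the super vector space `V` with even part
`V₀` and odd part `V₁`, where `Λ` is the Grassmann algebra on `n` generators. -/
def SPts (n : ℕ) (V₀ V₁ : Type u) [AddCommGroup V₀] [Module ℝ V₀] [AddCommGroup V₁] [Module ℝ V₁] :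
    Type u :=
  (Gras.Even n ⊗[ℝ] V₀) × (Gras.Odd n ⊗[ℝ] V₁)

section SPts

variable (n : ℕ) (V₀ V₁ W₀ W₁ : Type u)
  [AddCommGroup V₀] [Module ℝ V₀] [AddCommGroup V₁] [Module ℝ V₁]
  [AddCommGroup W₀] [Module ℝ W₀] [AddCommGroup W₁] [Module ℝ W₁]

instance : AddCommGroup (SPts n V₀ V₁) :=
  inferInstanceAs (AddCommGroup ((Gras.Even n ⊗[ℝ] V₀) × (Gras.Odd n ⊗[ℝ] V₁)))

instance : Module ℝ (SPts n V₀ V₁) :=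
  inferInstanceAs (Module ℝ ((Gras.Even n ⊗[ℝ] V₀) × (Gras.Odd n ⊗[ℝ] V₁)))

/-- The `Λ₀`-module structure, by multiplication on the left. -/
instance : Module (Gras.Even n) (SPts n V₀ V₁) :=
  inferInstanceAs (Module (Gras.Even n) ((Gras.Even n ⊗[ℝ] V₀) × (Gras.Odd n ⊗[ℝ] V₁)))

variable [TopologicalSpace V₀] [TopologicalSpace V₁] [TopologicalSpace W₀] [TopologicalSpace W₁]

instance : TopologicalSpace (SPts n V₀ V₁) :=
  inferInstanceAs (TopologicalSpace ((Gras.Even n ⊗[ℝ] V₀) × (Gras.Odd n ⊗[ℝ] V₁)))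

instance [IsLCS V₀] [IsLCS V₁] : IsLCS (SPts n V₀ V₁) :=
  inferInstanceAs (IsLCS ((Gras.Even n ⊗[ℝ] V₀) × (Gras.Odd n ⊗[ℝ] V₁)))

/-- The canonical isomorphism between the points of a product and the product of the points. -/
def SPts.prodEquiv : SPts n (V₀ × W₀) (V₁ × W₁) ≃L[ℝ] SPts n V₀ V₁ × SPts n W₀ W₁ where
  toLinearEquiv :=
    { toFun := fun x => (((FTensor.prodEquiv x.1).1, (FTensor.prodEquiv x.2).1),
        ((FTensor.prodEquiv x.1).2, (FTensor.prodEquiv x.2).2))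
      invFun := fun y => (FTensor.prodEquiv.symm (y.1.1, y.2.1),
        FTensor.prodEquiv.symm (y.1.2, y.2.2))
      map_add' := fun x y => by
        have h1 := map_add FTensor.prodEquiv x.1 y.1
        have h2 := map_add FTensor.prodEquiv x.2 y.2
        exact Prod.ext (Prod.ext (congrArg Prod.fst h1 :) (congrArg Prod.fst h2 :))
          (Prod.ext (congrArg Prod.snd h1 :) (congrArg Prod.snd h2 :))
      map_smul' := fun r x => by
        have h1 := map_smul FTensor.prodEquiv r x.1
        have h2 := map_smul FTensor.prodEquiv r x.2
        exact Prod.ext (Prod.ext (congrArg Prod.fst h1 :) (congrArg Prod.fst h2 :))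
          (Prod.ext (congrArg Prod.snd h1 :) (congrArg Prod.snd h2 :))
      left_inv := fun x => Prod.ext (LinearEquiv.symm_apply_apply _ x.1)
        (LinearEquiv.symm_apply_apply _ x.2)
      right_inv := fun y => by
        have h1 := LinearEquiv.apply_symm_apply FTensor.prodEquiv (y.1.1, y.2.1)
        have h2 := LinearEquiv.apply_symm_apply FTensor.prodEquiv (y.1.2, y.2.2)
        exact Prod.ext (Prod.ext (congrArg Prod.fst h1 :) (congrArg Prod.fst h2 :))
          (Prod.ext (congrArg Prod.snd h1 :) (congrArg Prod.snd h2 :)) }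
  continuous_toFun := by
    have h1 : Continuous fun x : (Gras.Even n ⊗[ℝ] (V₀ × W₀)) × (Gras.Odd n ⊗[ℝ] (V₁ × W₁)) =>
        FTensor.prodEquiv x.1 := FTensor.continuous_prodEquiv.comp continuous_fst
    have h2 : Continuous fun x : (Gras.Even n ⊗[ℝ] (V₀ × W₀)) × (Gras.Odd n ⊗[ℝ] (V₁ × W₁)) =>
        FTensor.prodEquiv x.2 := FTensor.continuous_prodEquiv.comp continuous_snd
    exact (h1.fst.prodMk h2.fst).prodMk (h1.snd.prodMk h2.snd)
  continuous_invFun := by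
    have h1 : Continuous fun y : ((Gras.Even n ⊗[ℝ] V₀) × (Gras.Odd n ⊗[ℝ] V₁)) ×
        ((Gras.Even n ⊗[ℝ] W₀) × (Gras.Odd n ⊗[ℝ] W₁)) =>
        FTensor.prodEquiv.symm (y.1.1, y.2.1) :=
      FTensor.continuous_prodEquiv_symm.comp (by fun_prop)
    have h2 : Continuous fun y : ((Gras.Even n ⊗[ℝ] V₀) × (Gras.Odd n ⊗[ℝ] V₁)) ×
        ((Gras.Even n ⊗[ℝ] W₀) × (Gras.Odd n ⊗[ℝ] W₁)) =>
        FTensor.prodEquiv.symm (y.1.2, y.2.2) :=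
      FTensor.continuous_prodEquiv_symm.comp (by fun_prop)
    exact h1.prodMk h2

theorem SPts.prodEquiv_smul (r : Gras.Even n) (x : SPts n (V₀ × W₀) (V₁ × W₁)) :
    SPts.prodEquiv n V₀ V₁ W₀ W₁ (r • x) = r • SPts.prodEquiv n V₀ V₁ W₀ W₁ x := by
  have h1 := FTensor.prodEquiv_smul r x.1
  have h2 := FTensor.prodEquiv_smul r x.2
  exact Prod.ext (Prod.ext (congrArg Prod.fst h1 :) (congrArg Prod.fst h2 :))
    (Prod.ext (congrArg Prod.snd h1 :) (congrArg Prod.snd h2 :))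

theorem SPts.prodEquiv_symm_smul (r : Gras.Even n) (y : SPts n V₀ V₁ × SPts n W₀ W₁) :
    (SPts.prodEquiv n V₀ V₁ W₀ W₁).symm (r • y) = r • (SPts.prodEquiv n V₀ V₁ W₀ W₁).symm y := by
  apply (SPts.prodEquiv n V₀ V₁ W₀ W₁).injective
  rw [SPts.prodEquiv_smul, ContinuousLinearEquiv.apply_symm_apply,
    ContinuousLinearEquiv.apply_symm_apply]

/-- Functoriality in the Grassmann algebra: the restriction of `φ ⊗ id`. -/
def SPts.map {Λ Λ' : Gr} (φ : Λ ⟶ Λ') : SPts Λ.gens V₀ V₁ →L[ℝ] SPts Λ'.gens V₀ V₁ :=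
  (FTensor.mapL (Gr.Hom.even φ)).prodMap (FTensor.mapL (Gr.Hom.odd φ))

theorem SPts.prodEquiv_map {Λ Λ' : Gr} (φ : Λ ⟶ Λ') (x : SPts Λ.gens (V₀ × W₀) (V₁ × W₁)) :
    SPts.prodEquiv _ V₀ V₁ W₀ W₁ (SPts.map _ _ φ x)
      = (SPts.map _ _ φ (SPts.prodEquiv _ V₀ V₁ W₀ W₁ x).1,
          SPts.map _ _ φ (SPts.prodEquiv _ V₀ V₁ W₀ W₁ x).2) := by
  have h1 := FTensor.mapL_prodEquiv (Gr.Hom.even φ) x.1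
  have h2 := FTensor.mapL_prodEquiv (Gr.Hom.odd φ) x.2
  exact Prod.ext (Prod.ext (congrArg Prod.fst h1 :) (congrArg Prod.fst h2 :))
    (Prod.ext (congrArg Prod.snd h1 :) (congrArg Prod.snd h2 :))

end SPts

/-- A `ℤ/2`-graded Fréchet space, given by its even and its odd part. -/
structure FSVect : Type (u + 1) where
  /-- The even part. -/
  ev : Type u
  /-- The odd part. -/
  od : Type u
  [addEv : AddCommGroup ev]
  [modEv : Module ℝ ev]
  [unifEv : UniformSpace ev]
  [uagEv : IsUniformAddGroup ev]
  [lcsEv : IsLCS ev]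
  [completeEv : CompleteSpace ev]
  [countEv : (uniformity ev).IsCountablyGenerated]
  [addOd : AddCommGroup od]
  [modOd : Module ℝ od]
  [unifOd : UniformSpace od]
  [uagOd : IsUniformAddGroup od]
  [lcsOd : IsLCS od]
  [completeOd : CompleteSpace od]
  [countOd : (uniformity od).IsCountablyGenerated]

attribute [instance] FSVect.addEv FSVect.modEv FSVect.unifEv FSVect.uagEv FSVect.lcsEv
  FSVect.completeEv FSVect.countEv FSVect.addOd FSVect.modOd FSVect.unifOd FSVect.uagOd
  FSVect.lcsOd FSVect.completeOd FSVect.countOd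

/-- The functor of points of a super vector space `V`, sending `Λ` to the even part of `Λ ⊗ V`. -/
abbrev FSVect.pts (V : FSVect.{u}) (Λ : Gr) : Type u := SPts Λ.gens V.ev V.od

/-- Functoriality in `Λ` of the functor of points. -/
abbrev FSVect.map (V : FSVect.{u}) {Λ Λ' : Gr} (φ : Λ ⟶ Λ') : V.pts Λ →L[ℝ] V.pts Λ' :=
  SPts.map V.ev V.od φ

/-- The product of two super vector spaces. -/
abbrev FSVect.prod (V W : FSVect.{u}) : FSVect.{u} where
  ev := V.ev × W.ev
  od := V.od × W.od

/-- The purely odd super vector space `ℝ^{0|n}`. -/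
abbrev FSVect.odd (n : ℕ) : FSVect.{u} where
  ev := PUnit
  od := ULift.{u} (Fin n) → ℝ
  lcsEv := { }
  lcsOd := { }

end SuperVect

/-! ### Supermanifolds -/

section Supermanifolds

/-- A chart of a functor `F`: an isomorphism, natural in `Λ` and a homeomorphism for each `Λ`, from
an open subfunctor of `F` onto a superdomain, that is, onto an open subfunctor of the functor of
points of a Fréchet super vector space. -/
structure SuperChart (F : Gr ⥤ TopCat.{u}) : Type (u + 1) where
  /-- The model space. -/
  V : FSVect.{u}
  /-- The components. -/
  chart : ∀ Λ : Gr, OpenPartialHomeomorph (F.obj Λ) (V.pts Λ)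
  map_source : ∀ {Λ Λ' : Gr} (φ : Λ ⟶ Λ') (x : F.obj Λ),
    x ∈ (chart Λ).source → F.map φ x ∈ (chart Λ').source
  chart_map : ∀ {Λ Λ' : Gr} (φ : Λ ⟶ Λ') (x : F.obj Λ),
    x ∈ (chart Λ).source → chart Λ' (F.map φ x) = V.map φ (chart Λ x)

/-- The domain of the coordinate expression of a natural transformation. -/
def SuperChart.dom {F G : Gr ⥤ TopCat.{u}} (c : SuperChart F) (d : SuperChart G) (α : F ⟶ G)
    (Λ : Gr) : Set (c.V.pts Λ) :=
  {y | y ∈ (c.chart Λ).target ∧ α.app Λ ((c.chart Λ).symm y) ∈ (d.chart Λ).source}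

/-- A natural transformation is supersmooth with respect to two charts if in coordinates each of
its components is smooth with a `Λ₀`-linear derivative. -/
def SuperChart.IsSupersmooth {F G : Gr ⥤ TopCat.{u}} (c : SuperChart F) (d : SuperChart G)
    (α : F ⟶ G) : Prop :=
  ∀ Λ : Gr, IsSmoothLin (Gras.Even Λ.gens)
    (fun y => d.chart Λ (α.app Λ ((c.chart Λ).symm y))) (c.dom d α Λ)

/-- A Fréchet supermanifold: a functor `F` on Grassmann algebras with a supersmooth atlas, whose
values are Hausdorff. The charts make each `F.obj Λ` a smooth Fréchet manifold. The atlas need not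
be maximal: it represents the maximal atlas that it generates. -/
structure SMan : Type (u + 1) where
  /-- The underlying functor. -/
  F : Gr ⥤ TopCat.{u}
  [t2 : ∀ Λ, T2Space (F.obj Λ)]
  /-- The charts. -/
  atlas : Set (SuperChart F)
  cover : ∀ (Λ : Gr) (x : F.obj Λ), ∃ c ∈ atlas, x ∈ (c.chart Λ).source
  compatible : ∀ c ∈ atlas, ∀ d ∈ atlas, c.IsSupersmooth d (𝟙 F)

attribute [instance] SMan.t2

/-- A morphism of supermanifolds: a supersmooth natural transformation. -/
@[ext]
structure SMan.Hom (M N : SMan.{u}) : Type u where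
  /-- The underlying natural transformation. -/
  app : M.F ⟶ N.F
  supersmooth : ∀ c ∈ M.atlas, ∀ d ∈ N.atlas, c.IsSupersmooth d app

theorem SuperChart.isOpen_dom {F G : Gr ⥤ TopCat.{u}} (c : SuperChart F) (d : SuperChart G)
    (α : F ⟶ G) (Λ : Gr) : IsOpen (c.dom d α Λ) := by
  have h : c.dom d α Λ = (c.chart Λ).target ∩
      (fun y => α.app Λ ((c.chart Λ).symm y)) ⁻¹' (d.chart Λ).source := rfl
  rw [h]
  refine ContinuousOn.isOpen_inter_preimage ?_ (c.chart Λ).open_target (d.chart Λ).open_source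
  exact (α.app Λ).hom.continuous.comp_continuousOn (c.chart Λ).continuousOn_symm

theorem SMan.comp_supersmooth {M N P : SMan.{u}} (α : SMan.Hom M N) (β : SMan.Hom N P) :
    ∀ c ∈ M.atlas, ∀ d ∈ P.atlas, c.IsSupersmooth d (α.app ≫ β.app) := by
  intro c hc e he Λ
  refine IsSmoothLin.of_local fun y hy => ?_
  obtain ⟨d, hd, hxd⟩ := N.cover Λ (α.app.app Λ ((c.chart Λ).symm y))
  refine ⟨c.dom e (α.app ≫ β.app) Λ ∩ c.dom d α.app Λ,
    (c.isOpen_dom e _ Λ).inter (c.isOpen_dom d _ Λ), ⟨hy, hy.1, hxd⟩, ?_⟩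
  have hO := (c.isOpen_dom e (α.app ≫ β.app) Λ).inter (c.isOpen_dom d α.app Λ)
  have h1 := (α.supersmooth c hc d hd Λ).mono
    (inter_subset_right (s := c.dom e (α.app ≫ β.app) Λ))
  have h2 := β.supersmooth d hd e he Λ
  refine (IsSmoothLin.comp hO (d.isOpen_dom e β.app Λ) ?_ h2 h1).congr hO ?_
  · rintro z ⟨hz, hz'⟩
    refine ⟨(d.chart Λ).map_source hz'.2, ?_⟩
    rw [(d.chart Λ).left_inv hz'.2]
    exact hz.2
  · rintro z ⟨hz, hz'⟩
    simp only [Function.comp]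
    rw [(d.chart Λ).left_inv hz'.2]
    rfl

instance : Category SMan.{u} where
  Hom := SMan.Hom
  id M := ⟨𝟙 M.F, M.compatible⟩
  comp α β := ⟨α.app ≫ β.app, SMan.comp_supersmooth α β⟩

@[ext]
theorem SMan.hom_ext {M N : SMan.{u}} {α β : M ⟶ N}
    (h : ∀ Λ (x : M.F.obj Λ), α.app.app Λ x = β.app.app Λ x) : α = β :=
  SMan.Hom.ext (NatTrans.ext (funext fun Λ => TopCat.hom_ext (ContinuousMap.ext (h Λ))))

/-! Products -/

/-- The pointwise product of functors. -/
def prodFunctor (F G : Gr ⥤ TopCat.{u}) : Gr ⥤ TopCat.{u} where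
  obj Λ := TopCat.of (F.obj Λ × G.obj Λ)
  map φ := TopCat.ofHom ((F.map φ).hom.prodMap (G.map φ).hom)
  map_id Λ := by
    refine TopCat.hom_ext (ContinuousMap.ext fun x => Prod.ext ?_ ?_)
    · exact ConcreteCategory.congr_hom (F.map_id Λ) x.1
    · exact ConcreteCategory.congr_hom (G.map_id Λ) x.2
  map_comp φ ψ := by
    refine TopCat.hom_ext (ContinuousMap.ext fun x => Prod.ext ?_ ?_)
    · exact ConcreteCategory.congr_hom (F.map_comp φ ψ) x.1
    · exact ConcreteCategory.congr_hom (G.map_comp φ ψ) x.2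

/-- The product of two charts. -/
def SuperChart.prod {F G : Gr ⥤ TopCat.{u}} (c : SuperChart F) (d : SuperChart G) :
    SuperChart (prodFunctor F G) where
  V := c.V.prod d.V
  chart Λ := ((c.chart Λ).prod (d.chart Λ)).transHomeomorph
    (SPts.prodEquiv Λ.gens c.V.ev c.V.od d.V.ev d.V.od).symm.toHomeomorph
  map_source φ x hx := ⟨c.map_source φ x.1 hx.1, d.map_source φ x.2 hx.2⟩
  chart_map {Λ Λ'} φ x hx := by
    apply (SPts.prodEquiv Λ'.gens c.V.ev c.V.od d.V.ev d.V.od).injective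
    have h1 := c.chart_map φ x.1 hx.1
    have h2 := d.chart_map φ x.2 hx.2
    rw [SPts.prodEquiv_map]
    refine ((SPts.prodEquiv Λ'.gens c.V.ev c.V.od d.V.ev d.V.od).apply_symm_apply _).trans ?_
    refine Prod.ext (h1.trans ?_) (h2.trans ?_)
    · exact congrArg (fun z => SPts.map _ _ φ (Prod.fst z))
        ((SPts.prodEquiv Λ.gens c.V.ev c.V.od d.V.ev d.V.od).apply_symm_apply
          (c.chart Λ x.1, d.chart Λ x.2)).symm
    · exact congrArg (fun z => SPts.map _ _ φ (Prod.snd z))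
        ((SPts.prodEquiv Λ.gens c.V.ev c.V.od d.V.ev d.V.od).apply_symm_apply
          (c.chart Λ x.1, d.chart Λ x.2)).symm

/-- The first projection. -/
def prodFst (F G : Gr ⥤ TopCat.{u}) : prodFunctor F G ⟶ F where
  app Λ := TopCat.ofHom ⟨Prod.fst, continuous_fst⟩

/-- The second projection. -/
def prodSnd (F G : Gr ⥤ TopCat.{u}) : prodFunctor F G ⟶ G where
  app Λ := TopCat.ofHom ⟨Prod.snd, continuous_snd⟩

/-- The pairing of two natural transformations. -/
def prodLift {X F G : Gr ⥤ TopCat.{u}} (α : X ⟶ F) (β : X ⟶ G) : X ⟶ prodFunctor F G where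
  app Λ := TopCat.ofHom ((α.app Λ).hom.prodMk (β.app Λ).hom)
  naturality Λ Λ' φ := by
    refine TopCat.hom_ext (ContinuousMap.ext fun x => Prod.ext ?_ ?_)
    · exact ConcreteCategory.congr_hom (α.naturality φ) x
    · exact ConcreteCategory.congr_hom (β.naturality φ) x

section ProdCalc

variable {F G : Gr ⥤ TopCat.{u}} (c : SuperChart F) (d : SuperChart G)

/-- The coordinates on a product. -/
abbrev SuperChart.pe (Λ : Gr) : (c.V.prod d.V).pts Λ ≃L[ℝ] c.V.pts Λ × d.V.pts Λ :=
  SPts.prodEquiv Λ.gens c.V.ev c.V.od d.V.ev d.V.od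

theorem SuperChart.mem_prod_target (Λ : Gr) (y : (c.V.prod d.V).pts Λ) :
    y ∈ ((c.prod d).chart Λ).target ↔
      (c.pe d Λ y).1 ∈ (c.chart Λ).target ∧ (c.pe d Λ y).2 ∈ (d.chart Λ).target := Iff.rfl

theorem SuperChart.prod_symm (Λ : Gr) (y : (c.V.prod d.V).pts Λ) :
    ((c.prod d).chart Λ).symm y
      = ((c.chart Λ).symm (c.pe d Λ y).1, (d.chart Λ).symm (c.pe d Λ y).2) := rfl

theorem SuperChart.prod_apply (Λ : Gr) (x : (prodFunctor F G).obj Λ) :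
    (c.prod d).chart Λ x = (c.pe d Λ).symm (c.chart Λ x.1, d.chart Λ x.2) := rfl

theorem SuperChart.mem_prod_source (Λ : Gr) (x : (prodFunctor F G).obj Λ) :
    x ∈ ((c.prod d).chart Λ).source ↔ x.1 ∈ (c.chart Λ).source ∧ x.2 ∈ (d.chart Λ).source := Iff.rfl

theorem SuperChart.smooth_pe (Λ : Gr) (U) : IsSmoothLin (Gras.Even Λ.gens) (c.pe d Λ) U :=
  isSmoothLin_clm (c.pe d Λ).toContinuousLinearMap (SPts.prodEquiv_smul _ _ _ _ _) U

theorem SuperChart.smooth_pe_symm (Λ : Gr) (U) :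
    IsSmoothLin (Gras.Even Λ.gens) (c.pe d Λ).symm U :=
  isSmoothLin_clm (c.pe d Λ).symm.toContinuousLinearMap (SPts.prodEquiv_symm_smul _ _ _ _ _) U

theorem SuperChart.smooth_fst (Λ : Gr) (U) :
    IsSmoothLin (Gras.Even Λ.gens) (fun y => (c.pe d Λ y).1) U :=
  isSmoothLin_clm ((ContinuousLinearMap.fst ℝ _ _).comp (c.pe d Λ).toContinuousLinearMap)
    (fun r x => congrArg Prod.fst (SPts.prodEquiv_smul _ _ _ _ _ r x)) U

theorem SuperChart.smooth_snd (Λ : Gr) (U) :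
    IsSmoothLin (Gras.Even Λ.gens) (fun y => (c.pe d Λ y).2) U :=
  isSmoothLin_clm ((ContinuousLinearMap.snd ℝ _ _).comp (c.pe d Λ).toContinuousLinearMap)
    (fun r x => congrArg Prod.snd (SPts.prodEquiv_smul _ _ _ _ _ r x)) U

theorem SuperChart.fst_supersmooth {X : Gr ⥤ TopCat.{u}} (e : SuperChart X) (α : F ⟶ X)
    (h : c.IsSupersmooth e α) : (c.prod d).IsSupersmooth e (prodFst F G ≫ α) := fun Λ =>
  IsSmoothLin.comp (g := fun z => e.chart Λ (α.app Λ ((c.chart Λ).symm z)))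
    (f := fun y => (c.pe d Λ y).1) ((c.prod d).isOpen_dom e _ Λ) (c.isOpen_dom e α Λ)
    (fun _ hy => ⟨hy.1.1, hy.2⟩) (h Λ) (c.smooth_fst d Λ _)

theorem SuperChart.snd_supersmooth {X : Gr ⥤ TopCat.{u}} (e : SuperChart X) (α : G ⟶ X)
    (h : d.IsSupersmooth e α) : (c.prod d).IsSupersmooth e (prodSnd F G ≫ α) := fun Λ =>
  IsSmoothLin.comp (g := fun z => e.chart Λ (α.app Λ ((d.chart Λ).symm z)))
    (f := fun y => (c.pe d Λ y).2) ((c.prod d).isOpen_dom e _ Λ) (d.isOpen_dom e α Λ)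
    (fun _ hy => ⟨hy.1.2, hy.2⟩) (h Λ) (c.smooth_snd d Λ _)

theorem SuperChart.lift_supersmooth {X : Gr ⥤ TopCat.{u}} (e : SuperChart X) (α : X ⟶ F)
    (β : X ⟶ G) (hα : e.IsSupersmooth c α) (hβ : e.IsSupersmooth d β) :
    e.IsSupersmooth (c.prod d) (prodLift α β) := fun Λ =>
  IsSmoothLin.comp (g := (c.pe d Λ).symm) (f := fun y =>
      (c.chart Λ (α.app Λ ((e.chart Λ).symm y)), d.chart Λ (β.app Λ ((e.chart Λ).symm y))))
    (e.isOpen_dom (c.prod d) (prodLift α β) Λ) isOpen_univ (mapsTo_univ _ _)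
    (c.smooth_pe_symm d Λ univ)
    (((hα Λ).mono fun _ hy => ⟨hy.1, hy.2.1⟩).prodMk ((hβ Λ).mono fun _ hy => ⟨hy.1, hy.2.2⟩))

end ProdCalc

/-- The product of two supermanifolds. -/
def SMan.prod (M N : SMan.{u}) : SMan.{u} where
  F := prodFunctor M.F N.F
  t2 Λ := inferInstanceAs (T2Space (M.F.obj Λ × N.F.obj Λ))
  atlas := {e | ∃ c ∈ M.atlas, ∃ d ∈ N.atlas, e = c.prod d}
  cover Λ x := by
    obtain ⟨c, hc, hx⟩ := M.cover Λ x.1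
    obtain ⟨d, hd, hx'⟩ := N.cover Λ x.2
    exact ⟨c.prod d, ⟨c, hc, d, hd, rfl⟩, hx, hx'⟩
  compatible := by
    rintro _ ⟨c, hc, d, hd, rfl⟩ _ ⟨c', hc', d', hd', rfl⟩
    exact SuperChart.lift_supersmooth c' d' (c.prod d) (prodFst _ _ ≫ 𝟙 _) (prodSnd _ _ ≫ 𝟙 _)
      (c.fst_supersmooth d c' _ (M.compatible c hc c' hc'))
      (c.snd_supersmooth d d' _ (N.compatible d hd d' hd'))

/-- The first projection. -/
def SMan.fst (M N : SMan.{u}) : M.prod N ⟶ M where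
  app := prodFst M.F N.F
  supersmooth := by
    rintro _ ⟨c, hc, d, hd, rfl⟩ c' hc'
    exact c.fst_supersmooth d c' _ (M.compatible c hc c' hc')

/-- The second projection. -/
def SMan.snd (M N : SMan.{u}) : M.prod N ⟶ N where
  app := prodSnd M.F N.F
  supersmooth := by
    rintro _ ⟨c, hc, d, hd, rfl⟩ d' hd'
    exact c.snd_supersmooth d d' _ (N.compatible d hd d' hd')

/-- The pairing `x ↦ (α x, β x)` of two morphisms. -/
def SMan.lift {X M N : SMan.{u}} (α : X ⟶ M) (β : X ⟶ N) : X ⟶ M.prod N where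
  app := prodLift α.app β.app
  supersmooth := by
    rintro e he _ ⟨c, hc, d, hd, rfl⟩
    exact c.lift_supersmooth d e _ _ (α.supersmooth e he c hc) (β.supersmooth e he d hd)

/-! Superpoints -/

/-- The `Λ'`-points of the superpoint of `Λ`, i.e. the morphisms `Λ → Λ'`. -/
@[ext]
structure SPoint (Λ Λ' : Gr) : Type u where
  /-- The morphism of Grassmann algebras. -/
  hom : Λ ⟶ Λ'

theorem subsingleton_tensor_punit (A : Type) [AddCommGroup A] [Module ℝ A] (x y : A ⊗[ℝ] PUnit.{u + 1}) :
    x = y := by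
  have h : ∀ x : A ⊗[ℝ] PUnit.{u + 1}, x = 0 := fun x => by
    induction x using TensorProduct.induction_on with
    | zero => rfl
    | tmul a e => rw [Subsingleton.elim e 0, TensorProduct.tmul_zero]
    | add x y hx hy => rw [hx, hy, add_zero]
  rw [h x, h y]

/-- The identification `A ⊗ ℝⁿ ≅ Aⁿ`. -/
def oddCoord (A : Type) [AddCommGroup A] [Module ℝ A] (n : ℕ) :
    A ⊗[ℝ] (ULift.{u} (Fin n) → ℝ) ≃ₗ[ℝ] (Fin n → A) :=
  TensorProduct.piScalarRight ℝ ℝ A (ULift.{u} (Fin n)) ≪≫ₗ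
    LinearEquiv.funCongrLeft ℝ A Equiv.ulift.symm

theorem oddCoord_tmul {A : Type} [AddCommGroup A] [Module ℝ A] {n : ℕ} (a : A)
    (v : ULift.{u} (Fin n) → ℝ) (i : Fin n) : oddCoord A n (a ⊗ₜ[ℝ] v) i = v ⟨i⟩ • a := by
  simp [oddCoord]

theorem oddCoord_symm {A : Type} [AddCommGroup A] [Module ℝ A] {n : ℕ} (f : Fin n → A) :
    (oddCoord.{u} A n).symm f = ∑ i, f i ⊗ₜ[ℝ] (Pi.single ⟨i⟩ 1 : ULift.{u} (Fin n) → ℝ) := by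
  rw [LinearEquiv.symm_apply_eq, map_sum]
  funext j
  simp [Finset.sum_apply, oddCoord_tmul, Pi.single_apply]

theorem oddCoord_mapL {A B : Type} [AddCommGroup A] [Module ℝ A] [AddCommGroup B] [Module ℝ B]
    {n : ℕ} (f : A →ₗ[ℝ] B) (x : A ⊗[ℝ] (ULift.{u} (Fin n) → ℝ)) (i : Fin n) :
    oddCoord B n (FTensor.mapL f x) i = f (oddCoord A n x i) := by
  induction x using TensorProduct.induction_on with
  | zero => simp
  | tmul a e => rw [FTensor.mapL_tmul, oddCoord_tmul, oddCoord_tmul, map_smul]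
  | add x y hx hy => simp only [map_add, Pi.add_apply, hx, hy]

theorem oddCoord_smul {A : Type} [AddCommGroup A] [Module ℝ A] {R : Type*} [Ring R]
    [Module R A] [SMulCommClass ℝ R A] {n : ℕ} (r : R) (x : A ⊗[ℝ] (ULift.{u} (Fin n) → ℝ))
    (i : Fin n) : oddCoord A n (r • x) i = r • oddCoord A n x i := by
  induction x using TensorProduct.induction_on with
  | zero => simp
  | tmul a e => rw [TensorProduct.smul_tmul', oddCoord_tmul, oddCoord_tmul, smul_comm]
  | add x y hx hy => simp only [smul_add, map_add, Pi.add_apply, hx, hy]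

theorem oddCoord_contract {A : Type} [AddCommGroup A] [Module ℝ A] {n : ℕ} (l : A →ₗ[ℝ] ℝ)
    (x : A ⊗[ℝ] (ULift.{u} (Fin n) → ℝ)) (i : Fin n) :
    l (oddCoord A n x i) = FTensor.contract l x ⟨i⟩ := by
  induction x using TensorProduct.induction_on with
  | zero => simp
  | tmul a e => rw [FTensor.contract_tmul, oddCoord_tmul, map_smul]; simp [mul_comm]
  | add x y hx hy => simp only [map_add, Pi.add_apply, hx, hy]

instance : IsLCS PUnit.{u + 1} where

instance (n : ℕ) : IsLCS (ULift.{u} (Fin n) → ℝ) where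

/-- The global coordinates `Hom(Λ, Λ') ≅ Λ'₁ ⊗ ℝⁿ` of the superpoint of `Λ`, given by the images of
the `n` generators of `Λ`. -/
def SPoint.coord (Λ Λ' : Gr) : SPoint.{u} Λ Λ' ≃ (FSVect.odd.{u} Λ.gens).pts Λ' where
  toFun p := (0, (oddCoord (Gras.Odd Λ'.gens) Λ.gens).symm (Gr.homEquiv Λ Λ' p.hom))
  invFun x := ⟨(Gr.homEquiv Λ Λ').symm (oddCoord (Gras.Odd Λ'.gens) Λ.gens x.2)⟩
  left_inv p := by
    refine SPoint.ext ((Gr.homEquiv Λ Λ').injective ?_)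
    simp
  right_inv x := by
    refine Prod.ext (subsingleton_tensor_punit _ _ _) ?_
    exact (congrArg _ (Equiv.apply_symm_apply _ _)).trans (LinearEquiv.symm_apply_apply _ _)

instance (Λ Λ' : Gr) : TopologicalSpace (SPoint.{u} Λ Λ') :=
  TopologicalSpace.induced (SPoint.coord Λ Λ') inferInstance

/-- The coordinates as a homeomorphism. -/
def SPoint.homeo (Λ Λ' : Gr) : SPoint.{u} Λ Λ' ≃ₜ (FSVect.odd.{u} Λ.gens).pts Λ' :=
  (SPoint.coord Λ Λ').toHomeomorphOfIsInducing ⟨rfl⟩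

theorem SPoint.coord_comp {Λ Λ' Λ'' : Gr} (p : SPoint.{u} Λ Λ') (ψ : Λ' ⟶ Λ'') :
    SPoint.coord Λ Λ'' ⟨p.hom ≫ ψ⟩ = (FSVect.odd Λ.gens).map ψ (SPoint.coord Λ Λ' p) := by
  refine Prod.ext (subsingleton_tensor_punit _ _ _) ?_
  apply (oddCoord (Gras.Odd Λ''.gens) Λ.gens).injective
  funext i
  refine (congrFun (LinearEquiv.apply_symm_apply _ _) i).trans ?_
  refine Eq.trans ?_ (oddCoord_mapL (Gr.Hom.odd ψ) (SPoint.coord Λ Λ' p).2 i).symm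
  have h : oddCoord (Gras.Odd Λ'.gens) Λ.gens (SPoint.coord Λ Λ' p).2 i
      = Gr.homEquiv Λ Λ' p.hom i := congrFun (LinearEquiv.apply_symm_apply _ _) i
  rw [h]; rfl

/-- The functor of points of the superpoint of `Λ`. -/
def SPoint.functor (Λ : Gr) : Gr ⥤ TopCat.{u} where
  obj Λ' := TopCat.of (SPoint.{u} Λ Λ')
  map ψ := TopCat.ofHom ⟨fun p => ⟨p.hom ≫ ψ⟩, by
    refine continuous_induced_rng.2 ?_
    have h : (SPoint.coord Λ _ ∘ fun p : SPoint.{u} Λ _ => (⟨p.hom ≫ ψ⟩ : SPoint.{u} Λ _))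
        = (FSVect.odd Λ.gens).map ψ ∘ SPoint.coord Λ _ := funext fun p => SPoint.coord_comp p ψ
    rw [h]
    exact ((FSVect.odd Λ.gens).map ψ).continuous.comp continuous_induced_dom⟩
  map_id _ := rfl
  map_comp _ _ := rfl

/-- The global chart of a superpoint. -/
def SPoint.superChart (Λ : Gr) : SuperChart (SPoint.functor.{u} Λ) where
  V := FSVect.odd Λ.gens
  chart Λ' := (SPoint.homeo Λ Λ').toOpenPartialHomeomorph
  map_source _ _ _ := trivial
  chart_map ψ p _ := SPoint.coord_comp p ψ

section Eval

attribute [local instance] Gras.topology Gras.finite Gras.isLCS Gras.continuousMul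

/-- The odd element with coordinates `x` in the direction `v`. -/
def oddEval (m : ℕ) (Λ : Gr) (v : Fin m → ℝ) : (FSVect.odd.{u} m).pts Λ →L[ℝ] Λ.Alg where
  toFun x := ∑ i, v i • (oddCoord (Gras.Odd Λ.gens) m x.2 i : Λ.Alg)
  map_add' x y := by
    rw [← Finset.sum_add_distrib]
    refine Finset.sum_congr rfl fun i _ => ?_
    rw [← smul_add]
    exact congrArg (fun z : Fin m → Gras.Odd Λ.gens => v i • (z i : Λ.Alg))
      (map_add (oddCoord (Gras.Odd Λ.gens) m) x.2 y.2)
  map_smul' r x := by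
    rw [RingHom.id_apply, Finset.smul_sum]
    refine Finset.sum_congr rfl fun i _ => ?_
    rw [smul_comm r]
    exact congrArg (fun z : Fin m → Gras.Odd Λ.gens => v i • (z i : Λ.Alg))
      (map_smul (oddCoord (Gras.Odd Λ.gens) m) r x.2)
  cont := by
    refine Gras.continuous_of_coords fun l => ?_
    have h : ∀ x : (FSVect.odd.{u} m).pts Λ,
        l (∑ i, v i • (oddCoord (Gras.Odd Λ.gens) m x.2 i : Λ.Alg))
          = ∑ i, v i • FTensor.contract (l ∘ₗ Submodule.subtype _) x.2 ⟨i⟩ := fun x => by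
      rw [map_sum]
      refine Finset.sum_congr rfl fun i _ => ?_
      rw [map_smul, ← oddCoord_contract]; rfl
    refine Continuous.congr ?_ fun x => (h x).symm
    have h2 : Continuous fun x : (Gras.Even Λ.gens ⊗[ℝ] PUnit.{u + 1}) ×
        (Gras.Odd Λ.gens ⊗[ℝ] (ULift.{u} (Fin m) → ℝ)) =>
        ∑ i, v i • FTensor.contract (l ∘ₗ Submodule.subtype _) x.2 ⟨i⟩ :=
      continuous_finsetSum _ fun i _ => by
        have h3 := (FTensor.continuous_contract (E := ULift.{u} (Fin m) → ℝ)
          (l ∘ₗ Submodule.subtype (Gras.Odd Λ.gens)))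
        have h4 : Continuous fun y => FTensor.contract (E := ULift.{u} (Fin m) → ℝ)
            (l ∘ₗ Submodule.subtype (Gras.Odd Λ.gens)) y ⟨i⟩ :=
          (continuous_apply (A := fun _ => ℝ) (ULift.up.{u} i)).comp h3
        have h5 := h4.comp (continuous_snd (X := Gras.Even Λ.gens ⊗[ℝ] PUnit.{u + 1}))
        exact h5.const_smul (v i)
    exact h2

theorem SPoint.smooth_eval (Λ Λ' : Gr) (a : Λ.Alg) :
    IsSmoothLin (Gras.Even Λ'.gens) (fun x : (FSVect.odd.{u} Λ.gens).pts Λ' =>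
      ((SPoint.coord Λ Λ').symm x).hom.toAlgHom a) univ := by
  induction a using ExteriorAlgebra.induction with
  | algebraMap r =>
    have h : ∀ x : (FSVect.odd.{u} Λ.gens).pts Λ',
        ((SPoint.coord Λ Λ').symm x).hom.toAlgHom (algebraMap ℝ _ r) = algebraMap ℝ _ r :=
      fun x => AlgHom.commutes _ r
    simp_rw [h]
    exact isSmoothLin_const _ _
  | ι v =>
    have h : ∀ x : (FSVect.odd.{u} Λ.gens).pts Λ',
        ((SPoint.coord Λ Λ').symm x).hom.toAlgHom (ExteriorAlgebra.ι ℝ v)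
          = oddEval Λ.gens Λ' v x := fun x => by
      refine (Gr.liftGens_ι _ _ _ v).trans ?_
      simp [Gr.genMap, Fintype.linearCombination_apply, oddEval]
    simp_rw [h]
    refine isSmoothLin_clm _ (fun r x => ?_) _
    change ∑ i, v i • (oddCoord (Gras.Odd Λ'.gens) Λ.gens (r • x.2) i : Λ'.Alg)
      = r • ∑ i, v i • (oddCoord (Gras.Odd Λ'.gens) Λ.gens x.2 i : Λ'.Alg)
    rw [Finset.smul_sum]
    refine Finset.sum_congr rfl fun i _ => ?_
    rw [oddCoord_smul, smul_comm r]
    rfl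
  | mul a b ha hb =>
    simp_rw [map_mul]
    exact Gras.isSmoothLin_mul isOpen_univ ha hb
  | add a b ha hb =>
    simp_rw [map_add]
    exact ha.add isOpen_univ hb

/-- The map sending `a` to its odd part times the `i`-th odd basis vector. -/
def oddSingleₗ (n : ℕ) (Λ : Gr) (i : Fin n) : Λ.Alg →ₗ[ℝ] (FSVect.odd.{u} n).pts Λ :=
  LinearMap.inr ℝ (Gras.Even Λ.gens ⊗[ℝ] PUnit.{u + 1})
      (Gras.Odd Λ.gens ⊗[ℝ] (ULift.{u} (Fin n) → ℝ)) ∘ₗ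
    (TensorProduct.mk ℝ (Gras.Odd Λ.gens) (ULift.{u} (Fin n) → ℝ)).flip (Pi.single ⟨i⟩ 1) ∘ₗ
    Gras.oddPart Λ.gens

theorem oddSingleₗ_apply (n : ℕ) (Λ : Gr) (i : Fin n) (a : Λ.Alg) :
    oddSingleₗ.{u} n Λ i a = ((0 : Gras.Even Λ.gens ⊗[ℝ] PUnit.{u + 1}),
      Gras.oddPart Λ.gens a ⊗ₜ[ℝ] (Pi.single ⟨i⟩ 1 : ULift.{u} (Fin n) → ℝ)) := rfl

/-- The same map as a continuous linear map. -/
def oddSingle (n : ℕ) (Λ : Gr) (i : Fin n) : Λ.Alg →L[ℝ] (FSVect.odd.{u} n).pts Λ :=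
  ⟨oddSingleₗ n Λ i, LinearMap.continuous_of_finiteDimensional _⟩

theorem oddSingle_smul (n : ℕ) (Λ : Gr) (i : Fin n) (r : Gras.Even Λ.gens) (a : Λ.Alg) :
    oddSingle.{u} n Λ i (r • a) = r • oddSingle n Λ i a := by
  change oddSingleₗ.{u} n Λ i (r • a) = r • oddSingleₗ n Λ i a
  rw [oddSingleₗ_apply, oddSingleₗ_apply, Gras.oddPart_smul, ← TensorProduct.smul_tmul']
  exact Prod.ext (smul_zero r).symm rfl

theorem SPoint.smooth_precomp {Λ Λ' : Gr} (φ : Λ ⟶ Λ') (Λ'' : Gr) :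
    IsSmoothLin (Gras.Even Λ''.gens) (fun x : (FSVect.odd.{u} Λ'.gens).pts Λ'' =>
      SPoint.coord.{u} Λ Λ'' ⟨φ ≫ ((SPoint.coord Λ' Λ'').symm x).hom⟩) univ := by
  have h : ∀ x : (FSVect.odd.{u} Λ'.gens).pts Λ'',
      SPoint.coord.{u} Λ Λ'' ⟨φ ≫ ((SPoint.coord Λ' Λ'').symm x).hom⟩
        = ∑ i, oddSingle Λ.gens Λ'' i (((SPoint.coord Λ' Λ'').symm x).hom.toAlgHom
            (φ.toAlgHom (Gras.gen _ i))) := fun x => by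
    refine Prod.ext (subsingleton_tensor_punit _ _ _) ?_
    refine (oddCoord_symm _).trans ?_
    have h2 : ∀ f : Fin Λ.gens → (Gras.Even Λ''.gens ⊗[ℝ] PUnit.{u + 1}) ×
        (Gras.Odd Λ''.gens ⊗[ℝ] (ULift.{u} (Fin Λ.gens) → ℝ)), (∑ i, f i).2 = ∑ i, (f i).2 :=
      fun f => Prod.snd_sum
    refine Eq.trans ?_ (h2 _).symm
    refine Finset.sum_congr rfl fun i _ => ?_
    change _ = Gras.oddPart _ _ ⊗ₜ[ℝ] _
    congr 1
    exact (Gras.oddPart_coe (Gr.homEquiv Λ Λ''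
      (φ ≫ ((SPoint.coord Λ' Λ'').symm x).hom) i)).symm
  simp_rw [h]
  refine IsSmoothLin.sum _ isOpen_univ fun i => ?_
  exact (isSmoothLin_clm _ (oddSingle_smul _ _ i) univ).comp isOpen_univ isOpen_univ
    (mapsTo_univ _ _) (SPoint.smooth_eval Λ' Λ'' _)

end Eval

/-- The superpoint of `Λ` as a supermanifold. -/
def SMan.point (Λ : Gr) : SMan.{u} where
  F := SPoint.functor Λ
  t2 Λ' := (SPoint.homeo Λ Λ').symm.t2Space
  atlas := {SPoint.superChart Λ}
  cover _ _ := ⟨_, rfl, trivial⟩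
  compatible := by
    rintro _ rfl _ rfl Λ'
    have h := isSmoothLin_clm (R := Gras.Even Λ'.gens) (ContinuousLinearMap.id ℝ _)
      (fun r x => rfl) ((SPoint.superChart Λ).dom (SPoint.superChart Λ) (𝟙 _) Λ')
    exact h.congr (SuperChart.isOpen_dom _ _ _ _) fun y _ =>
      ((SPoint.coord Λ Λ').apply_symm_apply y).symm

/-- The morphism of superpoints induced by a morphism `Λ → Λ'`, given on points by
precomposition. -/
def SMan.pointMap {Λ Λ' : Gr} (φ : Λ ⟶ Λ') : SMan.point.{u} Λ' ⟶ SMan.point.{u} Λ where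
  app :=
    { app := fun Λ'' => TopCat.ofHom ⟨fun p => ⟨φ ≫ p.hom⟩, by
        refine continuous_induced_rng.2 ?_
        have h := (SPoint.smooth_precomp.{u} φ Λ'').1 0
        have h' := (continuousOn_univ.1 h.continuousOn).comp (SPoint.homeo.{u} Λ' Λ'').continuous
        refine h'.congr fun p => ?_
        exact congrArg (fun q : SPoint.{u} Λ' Λ'' => SPoint.coord.{u} Λ Λ'' ⟨φ ≫ q.hom⟩)
          ((SPoint.coord Λ' Λ'').symm_apply_apply p)⟩
      naturality := fun _ _ ψ => rfl }
  supersmooth := by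
    rintro _ rfl _ rfl Λ''
    exact (SPoint.smooth_precomp.{u} φ Λ'').mono (subset_univ _)

end Supermanifolds

/-! ### Inner Hom functors and the diffeomorphism supergroup -/

section InnerHom

/-- The inner Hom functor: `Hom(M,N)(Λ)` is the set of morphisms `P(Λ) × M → N`, and a morphism
`φ : Λ → Λ'` acts by `σ ↦ σ ∘ (P(φ) × id)`. -/
def innerHom (M N : SMan.{u}) : Gr ⥤ Type u where
  obj Λ := (SMan.point.{u} Λ).prod M ⟶ N
  map {_ Λ'} φ := TypeCat.ofHom fun σ =>
    SMan.lift (SMan.fst (SMan.point Λ') M ≫ SMan.pointMap φ) (SMan.snd (SMan.point Λ') M) ≫ σ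
  map_id _ := rfl
  map_comp _ _ := rfl

/-- The composition `g ∘ (id × f)`, where `id × f : P(Λ) × M → P(Λ) × M'` is `(p, m) ↦ (p, f(p, m))`,
of `f ∈ Hom(M,M')(Λ)` and `g ∈ Hom(M',M'')(Λ)`. -/
def innerComp {M M' M'' : SMan.{u}} {Λ : Gr} (g : (innerHom M' M'').obj Λ)
    (f : (innerHom M M').obj Λ) : (innerHom M M'').obj Λ :=
  SMan.lift (SMan.fst (SMan.point Λ) M) f ≫ g

/-- The unit of `Hom(M,M)(Λ)`: the projection `P(Λ) × M → M`. -/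
def innerId (M : SMan.{u}) (Λ : Gr) : (innerHom M M).obj Λ := SMan.snd (SMan.point Λ) M

/-- `f` is invertible if it has a two-sided inverse for the composition. -/
def IsInvertible {M : SMan.{u}} {Λ : Gr} (f : (innerHom M M).obj Λ) : Prop :=
  ∃ g : (innerHom M M).obj Λ, innerComp f g = innerId M Λ ∧ innerComp g f = innerId M Λ

/-- The set `SDiff(M)(Λ)` of the invertible elements of `Hom(M,M)(Λ)`. -/
def SDiffSet (M : SMan.{u}) (Λ : Gr) : Set ((innerHom M M).obj Λ) := {f | IsInvertible f}

end InnerHom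

end

end SuperGeom

open SuperGeom

namespace SuperGeom

/-! Fix `Λ`. An element of `(innerHom M N).obj Λ` is a family of maps from `M` to `N` with parameter
space the superpoint of `Λ`; equivalently, a morphism from P(Λ) × M to P(Λ) × N over P(Λ). Under
this identification `innerComp` is ordinary composition over P(Λ), and `innerId` is the identity.
Hence supermanifolds and families over P(Λ) form a category, the endomorphisms of `M` in it form a
monoid, and SDiff(M)(Λ) is the group of units of that monoid.

A morphism φ : Λ → Λ' changes the parameter space along P(φ) : P(Λ') → P(Λ). This change of
parameter is a functor between the two categories of families, because the parameter is never
altered by a composition, only carried along (`innerHom_map_innerComp`, `innerHom_map_innerId`). A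
functor sends invertible endomorphisms to invertible ones, which gives the subfunctor
(`IsInvertible.map`), and it restricts to a homomorphism between the groups of units
(`SDiff.mapHom`).

Finally, finite products in a category of set-valued functors are formed pointwise. A group object
there is therefore a functor with a group structure on each value whose operations are natural.
Naturality of the unit and of the product is the homomorphism property, naturality of the inversion
follows from it, and the group axioms are checked at each `Λ`.

The analysis has all gone into the constructions: the chain rule makes composites supersmooth, and
`SPoint.smooth_precomp` makes P(φ) a morphism. What remains are identities between morphisms. As
supersmoothness is a proposition, such an identity concerns only the underlying maps on points. -/

/-! ### Families over a superpoint: composition and change of parameter -/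

/-- On points both sides are (p, m) ↦ h(p, g(p, f(p, m))), with the same parameter p in every place.
The two morphisms unfold to this same map and their remaining fields are proofs, so the equality is
definitional. -/
theorem innerComp_assoc {M₁ M₂ M₃ M₄ : SMan.{u}} {Λ : Gr} (h : (innerHom M₃ M₄).obj Λ)
    (g : (innerHom M₂ M₃).obj Λ) (f : (innerHom M₁ M₂).obj Λ) :
    innerComp (innerComp h g) f = innerComp h (innerComp g f) := rfl

/-- Pairing the two projections of P(Λ) × M gives the identity, by eta for pairs. -/
theorem innerComp_innerId {M N : SMan.{u}} {Λ : Gr} (f : (innerHom M N).obj Λ) :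
    innerComp f (innerId M Λ) = f := rfl

/-- The second component of the pairing (p, f(p, m)) is f(p, m). -/
theorem innerId_innerComp {M N : SMan.{u}} {Λ : Gr} (f : (innerHom M N).obj Λ) :
    innerComp (innerId N Λ) f = f := rfl

/-- Functoriality of the change of parameter. With q = P(φ)(p), both sides are (p, m) ↦ g(q, f(q,
m)): it makes no difference whether p is replaced by q once, before composing, or separately in each
factor. -/
theorem innerHom_map_innerComp {M₁ M₂ M₃ : SMan.{u}} {Λ Λ' : Gr} (φ : Λ ⟶ Λ')
    (g : (innerHom M₂ M₃).obj Λ) (f : (innerHom M₁ M₂).obj Λ) :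
    (innerHom M₁ M₃).map φ (innerComp g f)
      = innerComp ((innerHom M₂ M₃).map φ g) ((innerHom M₁ M₂).map φ f) := rfl

/-- The projection (p, m) ↦ m does not depend on the parameter. -/
theorem innerHom_map_innerId (M : SMan.{u}) {Λ Λ' : Gr} (φ : Λ ⟶ Λ') :
    (innerHom M M).map φ (innerId M Λ) = innerId M Λ' := rfl

/-! ### Invertible families and their groups -/

section SDiff

variable {M : SMan.{u}} {Λ Λ' : Gr}

theorem IsInvertible.innerId (M : SMan.{u}) (Λ : Gr) : IsInvertible (innerId M Λ) :=
  ⟨SuperGeom.innerId M Λ, innerComp_innerId _, innerComp_innerId _⟩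

/-- As in any monoid, the inverse of a composite is the composite of the inverses in the opposite
order. -/
theorem IsInvertible.innerComp {g f : (innerHom M M).obj Λ} (hg : IsInvertible g)
    (hf : IsInvertible f) : IsInvertible (innerComp g f) := by
  obtain ⟨g', h₁, h₂⟩ := hg
  obtain ⟨f', h₃, h₄⟩ := hf
  refine ⟨SuperGeom.innerComp f' g', ?_, ?_⟩
  -- Rebracketing g f f' g' isolates the inner pair f f', which cancels by `h₃` and leaves g g'.
  · rw [innerComp_assoc, ← innerComp_assoc f, h₃, innerId_innerComp, h₁]
  -- In f' g' g f the inner pair is g' g, and f' f is left.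
  · rw [innerComp_assoc, ← innerComp_assoc g', h₂, innerId_innerComp, h₄]

/-- A functor preserves isomorphisms: the image of an inverse is an inverse of the image. This is
what makes the sets of invertible elements a subfunctor. -/
theorem IsInvertible.map {f : (innerHom M M).obj Λ} (hf : IsInvertible f) (φ : Λ ⟶ Λ') :
    IsInvertible ((innerHom M M).map φ f) := by
  obtain ⟨g, h₁, h₂⟩ := hf
  refine ⟨(innerHom M M).map φ g, ?_, ?_⟩
  · rw [← innerHom_map_innerComp, h₁, innerHom_map_innerId]
  · rw [← innerHom_map_innerComp, h₂, innerHom_map_innerId]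

/-- The diffeomorphism supergroup as a subfunctor of the inner Hom functor. -/
def SDiff (M : SMan.{u}) : Subfunctor (innerHom M M) where
  obj := SDiffSet M
  map φ _ hf := IsInvertible.map hf φ

/-- The group of units of the monoid of endomorphisms, realised on the subset of invertible elements
rather than on pairs of an element and an inverse, so that its carrier is the value of the
subfunctor. -/
noncomputable instance (M : SMan.{u}) (Λ : Gr) : Group ((SDiff M).toFunctor.obj Λ) where
  mul g f := ⟨innerComp g.1 f.1, IsInvertible.innerComp g.2 f.2⟩
  one := ⟨innerId M Λ, IsInvertible.innerId M Λ⟩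
  -- Invertibility is a mere existence statement, so an inverse has to be chosen; two-sided inverses
  -- in a monoid are unique, so the choice has no effect. The chosen element is itself invertible
  -- with inverse `f`, and the two defining identities exchange their roles.
  inv f := ⟨f.2.choose, f.1, f.2.choose_spec.2, f.2.choose_spec.1⟩
  mul_assoc h g f := Subtype.ext (innerComp_assoc h.1 g.1 f.1)
  one_mul f := Subtype.ext (innerId_innerComp f.1)
  mul_one f := Subtype.ext (innerComp_innerId f.1)
  -- The second defining identity is the one with the inverse on the left.
  inv_mul_cancel f := Subtype.ext f.2.choose_spec.2

/-- The action of a morphism of Grassmann algebras on diffeomorphisms. -/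
noncomputable def SDiff.mapHom (M : SMan.{u}) (φ : Λ ⟶ Λ') :
    (SDiff M).toFunctor.obj Λ →* (SDiff M).toFunctor.obj Λ' where
  toFun := (SDiff M).toFunctor.map φ
  -- Both identities hold by definition because `innerHom_map_innerId` and `innerHom_map_innerComp`
  -- do, and elements of the subfunctor are compared through their underlying morphisms.
  map_one' := rfl
  map_mul' _ _ := rfl

/-! ### The group object in the functor category -/

/-- The tensor product in the functor category is the cartesian one, computed at each `Λ`. Each
axiom is thus an equation between functions on sets, and evaluation at a point turns it into the
corresponding group axiom. -/
noncomputable instance (M : SMan.{u}) : GrpObj (SDiff M).toFunctor where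
  one := { app Λ := TypeCat.ofHom fun _ => (1 : (SDiff M).toFunctor.obj Λ) }
  mul := { app Λ := TypeCat.ofHom fun p : (SDiff M).toFunctor.obj Λ × (SDiff M).toFunctor.obj Λ =>
      p.1 * p.2 }
  inv :=
    { app Λ := TypeCat.ofHom fun f : (SDiff M).toFunctor.obj Λ => f⁻¹
      naturality Λ Λ' φ := by
        ext f
        -- The inverses over `Λ` and over `Λ'` are chosen independently of each other, so this
        -- square does not commute by definition. It commutes since a group homomorphism preserves
        -- inverses.
        exact (map_inv (SDiff.mapHom M φ) f).symm }
  one_mul := by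
    ext Λ p
    -- Here `p` lies in the product of a one-point set with the group, so the group element is its
    -- second component; for the right unit law it is the first.
    exact one_mul (M := (SDiff M).toFunctor.obj Λ) p.2
  mul_one := by
    ext Λ p
    exact mul_one (M := (SDiff M).toFunctor.obj Λ) p.1
  mul_assoc := by
    ext Λ p
    -- Triples are bracketed to the left.
    exact mul_assoc (G := (SDiff M).toFunctor.obj Λ) p.1.1 p.1.2 p.2
  left_inv := by
    ext Λ f
    exact inv_mul_cancel (G := (SDiff M).toFunctor.obj Λ) f
  right_inv := by
    ext Λ f
    exact mul_inv_cancel (G := (SDiff M).toFunctor.obj Λ) f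

end SDiff

end SuperGeom

/-! ### The diffeomorphism supergroup -/

open SuperGeom
-- The existential form loses nothing. A subfunctor is determined by its sets, each group law by its
-- multiplication, and the structure of the group object by the components of its product, unit and
-- inversion; every one of these is fixed by a clause. The same group laws `grp` occur in the last
-- three clauses, which ties the group object to the groups.
theorem mainTheorem10 (M : SMan.{u}) :
    ∃ S : Subfunctor (innerHom M M),
      (∀ Λ : Gr, S.obj Λ = SDiffSet M Λ) ∧
      ∃ grp : ∀ Λ : Gr, Group (S.toFunctor.obj Λ),
        (∀ (Λ : Gr) (g f : S.toFunctor.obj Λ), (g * f).1 = innerComp g.1 f.1) ∧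
        (∀ Λ : Gr, (1 : S.toFunctor.obj Λ).1 = innerId M Λ) ∧
        (∀ (Λ Λ' : Gr) (φ : Λ ⟶ Λ'), ∃ h : S.toFunctor.obj Λ →* S.toFunctor.obj Λ',
          ∀ f : S.toFunctor.obj Λ, (h f).1 = (innerHom M M).map φ f.1) ∧
        ∃ G : GrpObj S.toFunctor,
          (∀ (Λ : Gr) (g f : S.toFunctor.obj Λ), G.mul.app Λ (g, f) = g * f) ∧
          (∀ Λ : Gr, G.one.app Λ PUnit.unit = (1 : S.toFunctor.obj Λ)) ∧
          (∀ (Λ : Gr) (f : S.toFunctor.obj Λ), G.inv.app Λ f = f⁻¹) :=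
  -- The structures found by `inferInstance` are the ones constructed above. Their operations were
  -- given by explicit formulas, so every compatibility clause holds by unfolding.
  ⟨SDiff M, fun _ => rfl, inferInstance, fun _ _ _ => rfl, fun _ => rfl,
    fun _ _ φ => ⟨SDiff.mapHom M φ, fun _ => rfl⟩, inferInstance, fun _ _ _ => rfl, fun _ => rfl,
    fun _ _ => rfl⟩
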